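/- Let $k\ge 1$. For $h:(0,\infty)\to[0,\infty)$ (measurable) put $\mu_{\ell;h}:=\int_0^\infty r^\ell h(r)\,dr$. Let $\mathcal F_1$ be the set of such $h$ with $\mu_{k-1;h}<\infty$ and $\mu_{k-1;h}^{-1}\int_0^1 r^{k-1}h(r)\,dr=1/2$; for $h\in\mathcal F_1$ write $\tilde h_k(r):=\mu_{k-1;h}^{-1}r^{k-1}h(r)$, and let $\mathcal F_1^4$ be the set of $h\in\mathcal F_1$ with $\int_0^\infty r^4\tilde h_k(r)\,dr<\infty$. Let $a_k>0$ be the unique constant for which $\phi_1(r):=\exp(-a_kr^2/2)$ belongs to $\mathcal F_1$. The parameter is $\boldsymbol\vartheta=(\boldsymbol\vartheta^{I},\vartheta^{II},\boldsymbol\vartheta^{III},\boldsymbol\vartheta^{IV})=(\boldsymbol\theta,\sigma^2,(\lambda_2,\dots,\lambda_k)',\operatorname{vec}\boldsymbol\beta)$. With $\lambda_1:=\prod_{j=2}^k\lambda_j^{-1}$, the parameter space $\boldsymbol\Theta$ consists of those $\boldsymbol\vartheta$ with $\boldsymbol\theta\in\mathbb R^k$, $\sigma^2>0$, $\lambda_1>\lambda_2>\dots>\lambda_k>0$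 (Assumption (A)) and $\boldsymbol\beta=(\boldsymbol\beta_1,\dots,\boldsymbol\beta_k)\in\mathcal{SO}_k$. Put $\boldsymbol\Lambda:=\operatorname{diag}(\lambda_1,\dots,\lambda_k)$, $\mathbf V:=\boldsymbol\beta\boldsymbol\Lambda\boldsymbol\beta'$, $\boldsymbol\Sigma:=\sigma^2\mathbf V$. For $g_1\in\mathcal F_1$, $\mathrm P^{(n)}_{\boldsymbol\vartheta;g_1}$ is the joint law of $n$ i.i.d. $k$-vectors $\mathbf X_1,\dots,\mathbf X_n$ with density $c\,|\boldsymbol\Sigma|^{-1/2}g_1\big(((\mathbf x-\boldsymbol\theta)'\boldsymbol\Sigma^{-1}(\mathbf x-\boldsymbol\theta))^{1/2}\big)$, $c$ the normalizing constant. Let $d_i:=\|\mathbf V^{-1/2}(\mathbf X_i-\boldsymbol\theta)\|$ and $\mathbf U_i:=\mathbf V^{-1/2}(\mathbf X_i-\boldsymbol\theta)/d_i$. Let $\mathbf H_k$ be the $k\times k^2$ matrix with $\mathbf H_k\operatorname{vec}\mathbf A=(A_{11},\dots,A_{kk})'$, $\mathbf K_k$ the $k^2\times k^2$ commutation matrix,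 $\mathbf M_k$ the $(k-1)\times k$ matrix $\big(-\lambda_1(\lambda_2^{-1},\dots,\lambda_k^{-1})'\ \vdots\ \mathbf I_{k-1}\big)$, $\mathbf G_k$ the $k^2\times k(k-1)/2$ matrix with columns $\mathbf e_j\otimes\boldsymbol\beta_h-\mathbf e_h\otimes\boldsymbol\beta_j$ ($j<h$), and $\mathbf L_k$ the $k(k-1)/2\times k^2$ matrix with rows $(\lambda_j-\lambda_h)(\boldsymbol\beta_h\otimes\boldsymbol\beta_j)'$ ($j<h$). With the Gaussian score $\varphi_{\phi_1}:=-\dot\phi_1/\phi_1$ (so $\varphi_{\phi_1}(r)=a_kr$), let $$\boldsymbol\Delta^{III}_{\boldsymbol\vartheta;\phi_1}:=\frac1{2\sqrt n}\mathbf M_k\mathbf H_k(\boldsymbol\Lambda^{-1/2}\boldsymbol\beta')^{\otimes2}\sum_{i=1}^n\operatorname{vec}\Big(\varphi_{\phi_1}\big(\tfrac{d_i}\sigma\big)\tfrac{d_i}\sigma\mathbf U_i\mathbf U_i'\Big),\qquad \boldsymbol\Delta^{IV}_{\boldsymbol\vartheta;\phi_1}:=\frac1{2\sqrt n}\mathbf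 G_k\mathbf L_k(\mathbf V^{\otimes2})^{-1/2}\sum_{i=1}^n\operatorname{vec}\Big(\varphi_{\phi_1}\big(\tfrac{d_i}\sigma\big)\tfrac{d_i}\sigma\mathbf U_i\mathbf U_i'\Big),$$ and, with $\mathcal J_k(\phi_1):=\int_0^\infty r^2\varphi_{\phi_1}^2(r)\tilde\phi_{1k}(r)\,dr$ $(=k(k+2))$ and $\nu_{jh}:=\lambda_j\lambda_h/(\lambda_j-\lambda_h)^2$, $$\boldsymbol\Gamma^{III}_{\boldsymbol\vartheta;\phi_1}:=\frac{\mathcal J_k(\phi_1)}{k(k+2)}\cdot\frac14\mathbf M_k\mathbf H_k[\mathbf I_{k^2}+\mathbf K_k](\boldsymbol\Lambda^{-1})^{\otimes2}\mathbf H_k'\mathbf M_k',\qquad \boldsymbol\Gamma^{IV}_{\boldsymbol\vartheta;\phi_1}:=\frac14\frac{\mathcal J_k(\phi_1)}{k(k+2)}\mathbf G_k\operatorname{diag}(\nu_{12}^{-1},\nu_{13}^{-1},\dots,\nu_{(k-1)k}^{-1})\mathbf G_k'.$$ Lemma. Fix $\boldsymbol\vartheta\in\boldsymbol\Theta$ and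 $g_1\in\mathcal F_1^4$, and write $D_k(g_1):=\mu_{k+1;g_1}/\mu_{k-1;g_1}$. Let $\hat{\boldsymbol\vartheta}=\hat{\boldsymbol\vartheta}^{(n)}$ be any root-$n$ consistent estimator of $\boldsymbol\vartheta$ under $\mathrm P^{(n)}_{\boldsymbol\vartheta;g_1}$, i.e. a measurable function of $(\mathbf X_1,\dots,\mathbf X_n)$, almost surely with values in $\boldsymbol\Theta$, such that $n^{1/2}(\hat{\boldsymbol\vartheta}-\boldsymbol\vartheta)=O_{\mathrm P}(1)$ under $\mathrm P^{(n)}_{\boldsymbol\vartheta;g_1}$. Then both $$\boldsymbol\Delta^{III}_{\hat{\boldsymbol\vartheta};\phi_1}-\boldsymbol\Delta^{III}_{\boldsymbol\vartheta;\phi_1}+a_k\frac{D_k(g_1)}k\,\boldsymbol\Gamma^{III}_{\boldsymbol\vartheta;\phi_1}\,n^{1/2}(\hat{\boldsymbol\vartheta}^{III}-\boldsymbol\vartheta^{III}) \quad\text{and}\quad \boldsymbol\Delta^{IV}_{\hat{\boldsymbol\vartheta};\phi_1}-\boldsymbol\Delta^{IV}_{\boldsymbol\vartheta;\phi_1}+a_k\frac{D_k(g_1)}k\,\boldsymbol\Gamma^{IV}_{\boldsymbol\vartheta;\phi_1}\,n^{1/2}(\hat{\boldsymbol\vartheta}^{IV}-\boldsymbol\vartheta^{IV})$$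 are $o_{\mathrm P}(1)$ under $\mathrm P^{(n)}_{\boldsymbol\vartheta;g_1}$ as $n\to\infty$. -/

import Mathlib

open MeasureTheory Filter Topology
open scoped Matrix Kronecker

noncomputable section

namespace EllipticalPCA

/-! ### Radial densities -/

/-- `μ_{ℓ;h} = ∫₀^∞ r^ℓ h(r) dr`. -/
def radialMoment (l : ℕ) (h : ℝ → ℝ) : ℝ := ∫ r in Set.Ioi (0 : ℝ), r ^ l * h r

/-- The class `𝓕` of radial densities in dimension `k`; only the values of `h` on `(0, ∞)`
matter. -/
structure IsRadial (k : ℕ) (h : ℝ → ℝ) : Prop where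
  measurable : Measurable h
  nonneg : ∀ r, 0 < r → 0 ≤ h r
  integrable : IntegrableOn (fun r => r ^ (k - 1) * h r) (Set.Ioi 0)

/-- The class `𝓕₁` of standardized radial densities: the distance has median one. -/
structure IsStdRadial (k : ℕ) (h : ℝ → ℝ) : Prop extends IsRadial k h where
  median : (radialMoment (k - 1) h)⁻¹ * ∫ r in (0 : ℝ)..1, r ^ (k - 1) * h r = 1 / 2

/-- The density `f̃_{1k}` of the standardized elliptical distance. -/
def distDensity (k : ℕ) (f : ℝ → ℝ) (r : ℝ) : ℝ :=
  if 0 < r then (radialMoment (k - 1) f)⁻¹ * (r ^ (k - 1) * f r) else 0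

/-- The class `𝓕₁⁴`: standardized radial densities with finite fourth-order moments. -/
structure IsStdRadial4 (k : ℕ) (h : ℝ → ℝ) : Prop extends IsStdRadial k h where
  fourth : IntegrableOn (fun r => r ^ 4 * distDensity k h r) (Set.Ioi 0)

/-- `D_k(g₁) = μ_{k+1;g₁} / μ_{k-1;g₁}`. -/
def Dconst (k : ℕ) (g : ℝ → ℝ) : ℝ := radialMoment (k + 1) g / radialMoment (k - 1) g

/-- The location score `φ_f = - f' / f`. -/
def score (f : ℝ → ℝ) (r : ℝ) : ℝ := - deriv f r / f r

/-- The radial Fisher information for shape, `∫₀^∞ r² φ_f(r)² f̃_{1k}(r) dr`. -/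
def infoJ (k : ℕ) (f : ℝ → ℝ) : ℝ :=
  ∫ r in Set.Ioi (0 : ℝ), r ^ 2 * score f r ^ 2 * distDensity k f r

/-- The Gaussian radial density `exp(- a r² / 2)`. -/
def gaussRadial (a r : ℝ) : ℝ := Real.exp (-(a * r ^ 2 / 2))

lemma gauss_integrable (m : ℕ) {a : ℝ} (ha : 0 < a) :
    IntegrableOn (fun r => r ^ m * gaussRadial a r) (Set.Ioi 0) := by
  have h := integrableOn_rpow_mul_exp_neg_mul_sq (b := a / 2) (by positivity) (s := m)
    (by have : (0 : ℝ) ≤ m := by positivity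
        linarith)
  refine h.congr_fun (fun r hr => ?_) measurableSet_Ioi
  simp only [gaussRadial, Real.rpow_natCast]
  congr 2
  ring

lemma gauss_scale (m : ℕ) (t r : ℝ) :
    t ^ m * (r ^ m * gaussRadial (t ^ 2) r) = (t * r) ^ m * gaussRadial 1 (t * r) := by
  simp only [gaussRadial]
  rw [mul_pow, mul_assoc]
  congr 4
  ring

lemma gauss_median_iff (m : ℕ) {t : ℝ} (ht : 0 < t) :
    IsStdRadial (m + 1) (gaussRadial (t ^ 2)) ↔
      ∫ r in (0 : ℝ)..t, r ^ m * gaussRadial 1 r = radialMoment m (gaussRadial 1) / 2 := by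
  have h1 : t ^ m * radialMoment m (gaussRadial (t ^ 2))
      = t⁻¹ * radialMoment m (gaussRadial 1) := by
    have := integral_comp_mul_left_Ioi (fun s => s ^ m * gaussRadial 1 s) 0 ht
    simp only [← gauss_scale, mul_zero, smul_eq_mul] at this
    rw [integral_const_mul] at this
    exact this
  have h2 : t ^ m * ∫ r in (0 : ℝ)..1, r ^ m * gaussRadial (t ^ 2) r
      = t⁻¹ * ∫ r in (0 : ℝ)..t, r ^ m * gaussRadial 1 r := by
    have := intervalIntegral.integral_comp_mul_left (a := 0) (b := 1)
      (fun s => s ^ m * gaussRadial 1 s) ht.ne'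
    simp only [← gauss_scale, mul_zero, mul_one, smul_eq_mul] at this
    rw [intervalIntegral.integral_const_mul] at this
    exact this
  have hpos : 0 < radialMoment m (gaussRadial 1) := by
    refine (setIntegral_pos_iff_support_of_nonneg_ae ?_ (gauss_integrable m one_pos)).2 ?_
    · filter_upwards [ae_restrict_mem measurableSet_Ioi] with r hr
      have : (0 : ℝ) < r := hr
      simp only [gaussRadial, Pi.zero_apply]
      positivity
    · have : Function.support (fun r : ℝ => r ^ m * gaussRadial 1 r) ∩ Set.Ioi 0
          = Set.Ioi 0 := by
        refine Set.inter_eq_right.2 fun r hr => ?_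
        have : (0 : ℝ) < r := hr
        simp only [gaussRadial, Function.mem_support]
        positivity
      rw [this]
      simp
  have htm : t ^ m ≠ 0 := by positivity
  have e1 : radialMoment m (gaussRadial (t ^ 2))
      = t⁻¹ * radialMoment m (gaussRadial 1) / t ^ m := by
    rw [← h1]; field_simp
  have e2 : ∫ r in (0 : ℝ)..1, r ^ m * gaussRadial (t ^ 2) r
      = t⁻¹ * (∫ r in (0 : ℝ)..t, r ^ m * gaussRadial 1 r) / t ^ m := by
    rw [← h2]; field_simp
  have key : (radialMoment m (gaussRadial (t ^ 2)))⁻¹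
        * ∫ r in (0 : ℝ)..1, r ^ m * gaussRadial (t ^ 2) r
      = (∫ r in (0 : ℝ)..t, r ^ m * gaussRadial 1 r) / radialMoment m (gaussRadial 1) := by
    rw [e1, e2]; field_simp
  constructor
  · intro h
    have := h.median
    simp only [Nat.add_sub_cancel] at this
    rw [key, div_eq_iff hpos.ne'] at this
    linarith
  · intro h
    refine ⟨⟨?_, ?_, ?_⟩, ?_⟩
    · unfold gaussRadial; fun_prop
    · intro r _; exact (Real.exp_pos _).le
    · simpa using gauss_integrable m (a := t ^ 2) (by positivity)
    · simp only [Nat.add_sub_cancel]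
      rw [key, h]; field_simp

/-- There is exactly one `a > 0` for which `exp(- a r² / 2)` is standardized. -/
theorem existsUnique_gaussConst (m : ℕ) :
    ∃! a : ℝ, 0 < a ∧ IsStdRadial (m + 1) (gaussRadial a) := by
  set g : ℝ → ℝ := fun r => r ^ m * gaussRadial 1 r with hg
  have hcont : Continuous g := by simp only [hg, gaussRadial]; fun_prop
  have hgpos : ∀ r, 0 < r → 0 < g r := fun r hr => by
    simp only [hg, gaussRadial]; positivity
  have hint : ∀ a b, IntervalIntegrable g volume a b := fun a b =>
    hcont.intervalIntegrable a b
  have hmono : ∀ s t : ℝ, 0 < s → s < t →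
      ∫ r in (0 : ℝ)..s, g r < ∫ r in (0 : ℝ)..t, g r := fun s t hs hst => by
    rw [← intervalIntegral.integral_add_adjacent_intervals (hint 0 s) (hint s t)]
    have := intervalIntegral.intervalIntegral_pos_of_pos_on (hint s t)
      (fun x hx => hgpos x (hs.trans hx.1)) hst
    linarith
  have hlim : Tendsto (fun t => ∫ r in (0 : ℝ)..t, g r) atTop
      (𝓝 (radialMoment m (gaussRadial 1))) :=
    intervalIntegral_tendsto_integral_Ioi 0 (gauss_integrable m one_pos) tendsto_id
  have hTpos : 0 < radialMoment m (gaussRadial 1) := by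
    have h01 : 0 < ∫ r in (0 : ℝ)..1, g r :=
      intervalIntegral.intervalIntegral_pos_of_pos_on (hint 0 1)
        (fun x hx => hgpos x hx.1) one_pos
    refine h01.trans_le (ge_of_tendsto hlim ?_)
    filter_upwards [eventually_gt_atTop 1] with t ht
    exact (hmono 1 t one_pos ht).le
  obtain ⟨T, hT, hT0⟩ := ((hlim.eventually_const_lt (half_lt_self hTpos)).and
    (eventually_gt_atTop 0)).exists
  have hcI : Continuous fun t => ∫ r in (0 : ℝ)..t, g r :=
    intervalIntegral.continuous_primitive hint 0
  obtain ⟨t, ⟨ht0, -⟩, ht⟩ := intermediate_value_Icc hT0.le hcI.continuousOn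
    (show radialMoment m (gaussRadial 1) / 2 ∈ Set.Icc _ _ from
      ⟨by rw [intervalIntegral.integral_same]; positivity, hT.le⟩)
  have htpos : 0 < t := by
    rcases ht0.eq_or_lt with h | h
    · subst h
      simp only [intervalIntegral.integral_same] at ht
      linarith
    · exact h
  refine ⟨t ^ 2, ⟨by positivity, (gauss_median_iff m htpos).2 ht⟩, ?_⟩
  rintro b ⟨hb, hbs⟩
  have hsb : 0 < Real.sqrt b := Real.sqrt_pos.2 hb
  rw [← Real.sq_sqrt hb.le] at hbs
  have hb' := (gauss_median_iff m hsb).1 hbs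
  rw [← Real.sq_sqrt hb.le]
  congr 1
  rcases lt_trichotomy (Real.sqrt b) t with h | h | h
  · have := hmono _ _ hsb h
    simp only [hg] at this ht
    linarith
  · exact h
  · have := hmono _ _ htpos h
    simp only [hg] at this ht
    linarith

/-- The constant `a_k`, `k = m + 1`: the positive number for which `exp(- a_k r² / 2)` belongs
to `𝓕₁`. -/
def gaussConst (m : ℕ) : ℝ := (existsUnique_gaussConst m).choose

/-- The standardized Gaussian radial density `φ₁` in dimension `k = m + 1`. -/
def phi1 (m : ℕ) : ℝ → ℝ := gaussRadial (gaussConst m)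

/-! ### The parameter `ϑ = (θ, σ², (λ₂, …, λ_k), vec β)`, in dimension `k = m + 1` -/

/-- Index set of a `k`-vector, `k = m + 1`. -/
abbrev Idx (m : ℕ) := Fin (m + 1)

/-- The ambient space `ℝ^{k(k+2)}` of the parameter, split into its four blocks. -/
abbrev Param (m : ℕ) := (Idx m → ℝ) × ℝ × (Fin m → ℝ) × (Idx m × Idx m → ℝ)

namespace Param

variable {m : ℕ} (t : Param m)

/-- Block I, the location `θ`. -/
def loc : Idx m → ℝ := t.1

/-- Block II, the squared scale `σ²`. -/
def scaleSq : ℝ := t.2.1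

/-- Block III, the eigenvalues `λ₂, …, λ_k` of the shape matrix. -/
def eigTail : Fin m → ℝ := t.2.2.1

/-- Block IV, `vec β`. -/
def vecBeta : Idx m × Idx m → ℝ := t.2.2.2

/-- The matrix `β` whose columns are stacked in block IV. -/
def beta : Matrix (Idx m) (Idx m) ℝ := Matrix.of fun i j => t.vecBeta (j, i)

lemma vec_beta : t.beta.vec = t.vecBeta := rfl

/-- The scale `σ`. -/
def scale : ℝ := Real.sqrt t.scaleSq

/-- All eigenvalues `λ₁, …, λ_k` of the shape, with `λ₁ = ∏_{j ≥ 2} λ_j⁻¹`. -/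
def eig : Idx m → ℝ := Fin.cons (∏ j, (t.eigTail j)⁻¹) t.eigTail

/-- The shape matrix `V = β Λ_V β'`. -/
def shape : Matrix (Idx m) (Idx m) ℝ := t.beta * Matrix.diagonal t.eig * t.betaᵀ

/-- The scatter matrix `Σ = σ² V`. -/
def scatter : Matrix (Idx m) (Idx m) ℝ := t.scaleSq • t.shape

/-- The symmetric root `V^{-1/2}`, written in the eigenbasis of `V`. -/
def shapeInvSqrt : Matrix (Idx m) (Idx m) ℝ :=
  t.beta * Matrix.diagonal (fun j => (Real.sqrt (t.eig j))⁻¹) * t.betaᵀ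

end Param

/-- The parameter space `Θ`, which includes `λ₁ > λ₂ > ⋯ > λ_k > 0`. -/
def ParamSpace (m : ℕ) : Set (Param m) :=
  {t | 0 < t.scaleSq ∧ StrictAnti t.eig ∧ (∀ j, 0 < t.eig j) ∧
    t.beta ∈ Matrix.specialOrthogonalGroup (Idx m) ℝ}

/-- On the parameter space, `shapeInvSqrt` is the positive definite square root of `V⁻¹`. -/
theorem shapeInvSqrt_spec {m : ℕ} {t : Param m} (ht : t ∈ ParamSpace m) :
    t.shapeInvSqrt.PosDef ∧ t.shapeInvSqrt * t.shapeInvSqrt = t.shape⁻¹ := by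
  obtain ⟨-, -, hpos, hb⟩ := ht
  have hb1 : t.betaᵀ * t.beta = 1 := by
    have := (Matrix.mem_orthogonalGroup_iff' (Idx m) ℝ).1 hb.1
    simpa [Matrix.star_eq_conjTranspose] using this
  have hb2 : t.beta * t.betaᵀ = 1 := mul_eq_one_comm.1 hb1
  constructor
  · have hd : (Matrix.diagonal (fun j => (Real.sqrt (t.eig j))⁻¹)).PosDef :=
      Matrix.PosDef.diagonal fun j => inv_pos.2 (Real.sqrt_pos.2 (hpos j))
    have hinj : Function.Injective (t.betaᵀ).mulVec := by
      intro x y hxy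
      have := congrArg (fun v => t.beta *ᵥ v) hxy
      simpa [Matrix.mulVec_mulVec, hb2] using this
    have := hd.conjTranspose_mul_mul_same (B := t.betaᵀ) hinj
    simpa [Param.shapeInvSqrt] using this
  · refine (Matrix.inv_eq_left_inv ?_).symm
    have h : ∀ D E : Matrix (Idx m) (Idx m) ℝ,
        (t.beta * D * t.betaᵀ) * (t.beta * E * t.betaᵀ) = t.beta * (D * E) * t.betaᵀ := by
      intro D E
      calc _ = t.beta * D * (t.betaᵀ * t.beta) * E * t.betaᵀ := by
            simp only [Matrix.mul_assoc]
        _ = _ := by rw [hb1]; simp only [Matrix.mul_assoc, Matrix.one_mul]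
    have h1 : (fun j => (Real.sqrt (t.eig j))⁻¹ * (Real.sqrt (t.eig j))⁻¹ * t.eig j)
        = fun _ => (1 : ℝ) := by
      funext j
      have := hpos j
      have hs : Real.sqrt (t.eig j) ≠ 0 := (Real.sqrt_pos.2 this).ne'
      field_simp
      rw [Real.sq_sqrt this.le]
    rw [Param.shapeInvSqrt, Param.shape, h, h, Matrix.diagonal_mul_diagonal,
      Matrix.diagonal_mul_diagonal, h1, Matrix.diagonal_one, Matrix.mul_one, hb2]

/-! ### The elliptical distributions -/

/-- The elliptical density with location `θ`, scatter `Σ` and radial density `f`; the first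
factor is the normalizing constant `c_{k,f}`. -/
def ellDensity {m : ℕ} (t : Param m) (f : ℝ → ℝ) (x : Idx m → ℝ) : ℝ :=
  (∫ z : Idx m → ℝ, f (Real.sqrt (z ⬝ᵥ z)))⁻¹ * (Real.sqrt t.scatter.det)⁻¹ *
    f (Real.sqrt ((x - t.loc) ⬝ᵥ t.scatter⁻¹ *ᵥ (x - t.loc)))

/-- The law of one observation under `(ϑ, f)`. -/
def obsLaw {m : ℕ} (t : Param m) (f : ℝ → ℝ) : Measure (Idx m → ℝ) :=
  volume.withDensity fun x => ENNReal.ofReal (ellDensity t f x)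

/-- `P^{(n)}_{ϑ;f}`, the joint law of `n` independent observations. -/
def sampleLaw {m : ℕ} (t : Param m) (f : ℝ → ℝ) (n : ℕ) : Measure (Fin n → Idx m → ℝ) :=
  Measure.pi fun _ => obsLaw t f

/-! ### Gaussian and other central sequences -/

section Central

variable {m : ℕ} (t : Param m)

/-- The distance `d(θ, V) = ‖V^{-1/2}(x - θ)‖`. -/
def ellDist (x : Idx m → ℝ) : ℝ :=
  Real.sqrt ((t.shapeInvSqrt *ᵥ (x - t.loc)) ⬝ᵥ (t.shapeInvSqrt *ᵥ (x - t.loc)))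

/-- The multivariate sign `U(θ, V) = V^{-1/2}(x - θ) / ‖V^{-1/2}(x - θ)‖`. -/
def ellSign (x : Idx m → ℝ) : Idx m → ℝ :=
  (ellDist t x)⁻¹ • (t.shapeInvSqrt *ᵥ (x - t.loc))

/-- `∑ᵢ vec(φ_f(dᵢ/σ) (dᵢ/σ) Uᵢ Uᵢ')`. -/
def scoreSum (f : ℝ → ℝ) {n : ℕ} (x : Fin n → Idx m → ℝ) : Idx m × Idx m → ℝ :=
  ∑ i, ((score f (ellDist t (x i) / t.scale) * (ellDist t (x i) / t.scale)) •
    Matrix.vecMulVec (ellSign t (x i)) (ellSign t (x i))).vec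

/-- `H_k`, characterized by `H_k vec A = (A₁₁, …, A_kk)'`. -/
def Hmat (m : ℕ) : Matrix (Idx m) (Idx m × Idx m) ℝ :=
  Matrix.of fun j p => if p.1 = j ∧ p.2 = j then 1 else 0

lemma Hmat_mulVec_vec (A : Matrix (Idx m) (Idx m) ℝ) : Hmat m *ᵥ A.vec = A.diag := by
  funext j
  simp only [Matrix.mulVec, dotProduct, Hmat, Matrix.of_apply, Matrix.diag, ite_mul, one_mul,
    zero_mul, Matrix.vec]
  rw [Finset.sum_eq_single (j, j)]
  · simp
  · rintro ⟨a, b⟩ - hab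
    exact if_neg fun h => hab (Prod.ext h.1 h.2)
  · simp

/-- The commutation matrix `K_k`. -/
def Kmat (m : ℕ) : Matrix (Idx m × Idx m) (Idx m × Idx m) ℝ :=
  ∑ i, ∑ j, Matrix.single i j (1 : ℝ) ⊗ₖ Matrix.single j i (1 : ℝ)

/-- The `(k-1) × k` matrix `M_k^{Λ_V} = (-λ₁ (λ₂⁻¹, …, λ_k⁻¹)' ⋮ I_{k-1})`. -/
def Mmat : Matrix (Fin m) (Idx m) ℝ :=
  Matrix.of fun i => Fin.cons (-(t.eig 0) * (t.eigTail i)⁻¹) (fun j => if i = j then 1 else 0)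

/-- Pairs of indices `j < h`. -/
abbrev UpperPair (m : ℕ) := {p : Idx m × Idx m // p.1 < p.2}

/-- `G_k^β`, with columns `e_j ⊗ β_h - e_h ⊗ β_j`, `j < h`. -/
def Gmat : Matrix (Idx m × Idx m) (UpperPair m) ℝ :=
  Matrix.of fun q p =>
    (Pi.single p.1.1 1 : Idx m → ℝ) q.1 * t.beta q.2 p.1.2
      - (Pi.single p.1.2 1 : Idx m → ℝ) q.1 * t.beta q.2 p.1.1

/-- `L_k^{β,Λ_V}`, with rows `(λ_j - λ_h)(β_h ⊗ β_j)'`, `j < h`. With this sign `centralIV` is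
the derivative of the log-likelihood along `vec SO_k`. -/
def Lmat : Matrix (UpperPair m) (Idx m × Idx m) ℝ :=
  Matrix.of fun p q =>
    (t.eig p.1.1 - t.eig p.1.2) * (t.beta q.1 p.1.2 * t.beta q.2 p.1.1)

/-- The eigenvalue part `Δ^{III}_{ϑ;f}` of the central sequence. -/
def centralIII (f : ℝ → ℝ) {n : ℕ} (x : Fin n → Idx m → ℝ) : Fin m → ℝ :=
  let A := Matrix.diagonal (fun j => (Real.sqrt (t.eig j))⁻¹) * t.betaᵀ
  (1 / (2 * Real.sqrt n)) • ((Mmat t * Hmat m * (A ⊗ₖ A)) *ᵥ scoreSum t f x)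

/-- The eigenvector part `Δ^{IV}_{ϑ;f}` of the central sequence. -/
def centralIV (f : ℝ → ℝ) {n : ℕ} (x : Fin n → Idx m → ℝ) : Idx m × Idx m → ℝ :=
  (1 / (2 * Real.sqrt n)) •
    ((Gmat t * Lmat t * (t.shapeInvSqrt ⊗ₖ t.shapeInvSqrt)) *ᵥ scoreSum t f x)

/-- `D_k(Λ_V) = ¼ M H [I + K] (Λ_V⁻¹)^{⊗2} H' M'`. -/
def Dmat : Matrix (Fin m) (Fin m) ℝ :=
  let A := Matrix.diagonal (fun j => (t.eig j)⁻¹)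
  (1 / 4 : ℝ) • (Mmat t * Hmat m * (1 + Kmat m) * (A ⊗ₖ A) * (Hmat m)ᵀ * (Mmat t)ᵀ)

/-- The information `Γ^{III}_{ϑ;f}`. -/
def infoIII (f : ℝ → ℝ) : Matrix (Fin m) (Fin m) ℝ :=
  (infoJ (m + 1) f / ((m + 1 : ℝ) * (m + 3))) • Dmat t

/-- `ν_{jh} = λ_j λ_h / (λ_j - λ_h)²`. -/
def nu (p : UpperPair m) : ℝ :=
  t.eig p.1.1 * t.eig p.1.2 / (t.eig p.1.1 - t.eig p.1.2) ^ 2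

/-- The information `Γ^{IV}_{ϑ;f}`. -/
def infoIV (f : ℝ → ℝ) : Matrix (Idx m × Idx m) (Idx m × Idx m) ℝ :=
  (1 / 4 * (infoJ (m + 1) f / ((m + 1 : ℝ) * (m + 3)))) •
    (Gmat t * Matrix.diagonal (fun p => (nu t p)⁻¹) * (Gmat t)ᵀ)

end Central

/-! ### Stochastic orders -/

/-- `Y_n = O_P(1)` under `P_n`. -/
def IsBoundedInProb {Ω : ℕ → Type*} [∀ n, MeasurableSpace (Ω n)] (P : ∀ n, Measure (Ω n))
    {E : Type*} [NormedAddCommGroup E] (Y : ∀ n, Ω n → E) : Prop :=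
  ∀ ε : ENNReal, 0 < ε → ∃ C : ℝ, ∀ᶠ n in atTop, P n {ω | C < ‖Y n ω‖} ≤ ε

/-- `Y_n = o_P(1)` under `P_n`. -/
def TendstoZeroInProb {Ω : ℕ → Type*} [∀ n, MeasurableSpace (Ω n)] (P : ∀ n, Measure (Ω n))
    {E : Type*} [NormedAddCommGroup E] (Y : ∀ n, Ω n → E) : Prop :=
  ∀ δ : ℝ, 0 < δ → Tendsto (fun n => P n {ω | δ < ‖Y n ω‖}) atTop (𝓝 0)

/-- A root-`n` consistent sequence of estimators of `t` under `P^{(n)}_{t;g}`: statistics with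
values in the parameter space (almost surely) such that `n^{1/2}(est_n - t) = O_P(1)`. -/
structure IsRootNConsistent {m : ℕ} (t : Param m) (g : ℝ → ℝ)
    (est : ∀ n : ℕ, (Fin n → Idx m → ℝ) → Param m) : Prop where
  measurable : ∀ n, Measurable (est n)
  mem_paramSpace : ∀ n, ∀ᵐ x ∂(sampleLaw t g n), est n x ∈ ParamSpace m
  bounded : IsBoundedInProb (sampleLaw t g) fun n x => Real.sqrt n • (est n x - t)

end EllipticalPCA

end

open Asymptotics

noncomputable section

namespace EllipticalPCA

/-! ### The Gaussian score and information -/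

/-! The Gaussian score is linear, so distances and signs recombine: on the parameter space both
central sequences equal `√n ∑ c_pq(s) S_pq`, where `S` is the empirical scatter about the location
of `s` and the coefficients `coefIII`, `coefIV` are differentiable at `t` (`centralIII_phi1`,
`centralIV_phi1`).

Moving the centre of `S` from the location of `s` to that of `t` costs location increments times
mean deviations, plus products of two location increments. By the weak law the scatter about the
true location tends to `κ Σ`, with `κ = D_k(g₁)/k`, and the mean deviation tends to `0`. Hence a
central sequence changes by `√n` times the increment of the deterministic function `s ↦ ∑ c_pq(s) κ
Σ_pq`, up to `√n · o(‖s - t‖)` uniformly over `s` near `t` in the parameter space. Root-`n`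
consistency turns this error into `o_P(1)` (`isLittleO_linearization`,
`tendstoZeroInProb_linearization`). As the bound is uniform, the estimator may depend on the data in
any way: no discretization and no contiguity are involved.

It remains to linearize that function at `t`. Put `E = β_t'β_s - I`. Orthogonality gives `E + E' =
-E'E`, so `E` is skew to first order; therefore `β_s' V_t β_s` has a first-order constant diagonal,
and off-diagonal entries `½(λ_h - λ_j)(E_hj - E_jh)` to first order (`transpose_beta_shape_beta`).
Block III reads only the diagonal, in a difference that vanishes at `t`, so only eigenvalue
increments survive. Block IV reads only off-diagonal entries, which vanish at `t`, so only the
rotation survives. The results are `-a_k κ` times the two information matrices, without cross terms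
(`coefIII_isLittleO`, `coefIV_isLittleO`). -/

lemma gaussConst_pos (m : ℕ) : 0 < gaussConst m := (existsUnique_gaussConst m).choose_spec.1.1

lemma score_gaussRadial (a r : ℝ) : score (gaussRadial a) r = a * r := by
  have h : HasDerivAt (gaussRadial a) (Real.exp (-(a * r ^ 2 / 2)) * (-(a * (2 * r) / 2))) r := by
    have := (((hasDerivAt_pow 2 r).const_mul a).div_const 2).neg.exp
    simpa only [Nat.cast_ofNat, Nat.add_one_sub_one, pow_one] using! this
  rw [score, h.deriv, gaussRadial]
  have := (Real.exp_pos (-(a * r ^ 2 / 2))).ne'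
  field_simp

/-- Both moments are Gamma values, and their ratio is `Γ(x + 1) = x Γ(x)`. Two applications of this
recursion evaluate the Gaussian information. -/
lemma radialMoment_gaussRadial_add_two (l : ℕ) {a : ℝ} (ha : 0 < a) :
    radialMoment (l + 2) (gaussRadial a) = (l + 1) / a * radialMoment l (gaussRadial a) := by
  have key : ∀ n : ℕ, radialMoment n (gaussRadial a)
      = (a / 2) ^ (-((n : ℝ) + 1) / 2) * (1 / 2) * Real.Gamma (((n : ℝ) + 1) / 2) := by
    intro n
    rw [← integral_rpow_mul_exp_neg_mul_rpow (p := 2) (q := n) two_pos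
      (by have : (0 : ℝ) ≤ n := by positivity
          linarith) (half_pos ha), radialMoment]
    refine setIntegral_congr_fun measurableSet_Ioi fun r _ => ?_
    simp only [gaussRadial, Real.rpow_natCast, Real.rpow_ofNat]
    congr 2
    ring
  rw [key, key]
  have h1 : (((l + 2 : ℕ) : ℝ) + 1) / 2 = ((l : ℝ) + 1) / 2 + 1 := by push_cast; ring
  have h2 : -(((l + 2 : ℕ) : ℝ) + 1) / 2 = -((l : ℝ) + 1) / 2 - 1 := by push_cast; ring
  rw [h1, h2, Real.Gamma_add_one (by positivity), Real.rpow_sub_one (by positivity)]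
  field_simp

lemma radialMoment_gaussRadial_pos (l : ℕ) {a : ℝ} (ha : 0 < a) :
    0 < radialMoment l (gaussRadial a) := by
  refine (setIntegral_pos_iff_support_of_nonneg_ae ?_ (gauss_integrable l ha)).2 ?_
  · filter_upwards [ae_restrict_mem measurableSet_Ioi] with r hr
    have : (0 : ℝ) < r := hr
    simp only [gaussRadial, Pi.zero_apply]
    positivity
  · have : Function.support (fun r : ℝ => r ^ l * gaussRadial a r) ∩ Set.Ioi 0 = Set.Ioi 0 := by
      refine Set.inter_eq_right.2 fun r hr => ?_
      have : (0 : ℝ) < r := hr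
      simp only [gaussRadial, Function.mem_support]
      positivity
    rw [this]
    simp

/-- With `k = m + 1` this is `k(k + 2)`, so the factor in front of both information matrices is `1`.
-/
lemma infoJ_gaussRadial (m : ℕ) {a : ℝ} (ha : 0 < a) :
    infoJ (m + 1) (gaussRadial a) = (m + 1) * (m + 3) := by
  have h : infoJ (m + 1) (gaussRadial a)
      = a ^ 2 * (radialMoment m (gaussRadial a))⁻¹ * radialMoment (m + 4) (gaussRadial a) := by
    rw [infoJ, radialMoment.eq_1 (m + 4), ← integral_const_mul]
    refine setIntegral_congr_fun measurableSet_Ioi fun r hr => ?_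
    simp only [score_gaussRadial, distDensity, if_pos (Set.mem_Ioi.1 hr), Nat.add_sub_cancel]
    ring
  have hp := (radialMoment_gaussRadial_pos m ha).ne'
  rw [h, radialMoment_gaussRadial_add_two (m + 2) ha, radialMoment_gaussRadial_add_two m ha]
  push_cast
  field_simp
  ring

lemma infoJ_phi1_div (m : ℕ) : infoJ (m + 1) (phi1 m) / ((m + 1 : ℝ) * (m + 3)) = 1 := by
  rw [phi1, infoJ_gaussRadial m (gaussConst_pos m), div_self (by positivity)]

/-! ### The Gaussian central sequences as linear functions of a scatter matrix -/

variable {m : ℕ}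

/-- The empirical scatter matrix about `θ`. -/
def scatterMean (θ : Idx m → ℝ) {n : ℕ} (x : Fin n → Idx m → ℝ) : Matrix (Idx m) (Idx m) ℝ :=
  (n : ℝ)⁻¹ • ∑ i, Matrix.vecMulVec (x i - θ) (x i - θ)

/-- With a linear score, `φ(d/σ)(d/σ) UU' = (a/σ²) d² UU'`, and `d²` cancels the normalization of
the signs. -/
lemma scoreSum_phi1 {s : Param m} (hs : s ∈ ParamSpace m) {n : ℕ} (x : Fin n → Idx m → ℝ) :
    scoreSum s (phi1 m) x = ((gaussConst m / s.scaleSq) • (s.shapeInvSqrt *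
      (∑ i, Matrix.vecMulVec (x i - s.loc) (x i - s.loc)) * s.shapeInvSqrtᵀ)).vec := by
  rw [scoreSum, Finset.mul_sum, Finset.sum_mul, Finset.smul_sum, Matrix.vec_sum]
  refine Finset.sum_congr rfl fun i _ => ?_
  congr 1
  rw [Matrix.mul_vecMulVec, Matrix.vecMulVec_mul, Matrix.vecMul_transpose, ellSign,
    Matrix.smul_vecMulVec, Matrix.vecMulVec_smul, smul_smul, smul_smul, phi1, score_gaussRadial]
  have hsc : s.scale ^ 2 = s.scaleSq := Real.sq_sqrt hs.1.le
  have hs0 : s.scale ≠ 0 := (Real.sqrt_pos.2 hs.1).ne'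
  -- At distance zero the sign is `0⁻¹ • 0`, and both sides vanish.
  by_cases hd : ellDist s (x i) = 0
  · have hz : s.shapeInvSqrt *ᵥ (x i - s.loc) = 0 := by
      have h := (Real.sqrt_eq_zero (Finset.sum_nonneg fun _ _ => mul_self_nonneg _)).1 hd
      exact dotProduct_self_eq_zero.1 h
    simp [hz]
  · congr 1
    rw [← hsc]
    field_simp

lemma transpose_beta_mul_beta {s : Param m} (hs : s ∈ ParamSpace m) : s.betaᵀ * s.beta = 1 := by
  have := (Matrix.mem_orthogonalGroup_iff' (Idx m) ℝ).1 hs.2.2.2.1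
  simpa [Matrix.star_eq_conjTranspose] using this

lemma shapeInvSqrt_transpose (s : Param m) : s.shapeInvSqrtᵀ = s.shapeInvSqrt := by
  simp [Param.shapeInvSqrt, Matrix.mul_assoc]

lemma rootInv_mul_rootInv {s : Param m} (hs : s ∈ ParamSpace m) :
    Matrix.diagonal (fun j => (Real.sqrt (s.eig j))⁻¹) *
      Matrix.diagonal (fun j => (Real.sqrt (s.eig j))⁻¹)
      = Matrix.diagonal (fun j => (s.eig j)⁻¹) := by
  rw [Matrix.diagonal_mul_diagonal]
  congr 1
  funext j
  rw [← mul_inv, Real.mul_self_sqrt (hs.2.2.1 j).le]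

lemma mulVec_apply_eq_sum {ι κ : Type*} [Fintype κ] (A : Matrix ι κ ℝ) (v : κ → ℝ) (i : ι) :
    (A *ᵥ v) i = ∑ j, A i j * v j := rfl

lemma mulVec_Mmat (s : Param m) (v : Idx m → ℝ) (i : Fin m) :
    (Mmat s *ᵥ v) i = v i.succ - s.eig 0 * (s.eigTail i)⁻¹ * v 0 := by
  simp [Matrix.mulVec, dotProduct, Mmat, Fin.sum_univ_succ, ite_mul]
  ring

lemma transpose_mul_mul_apply (B S : Matrix (Idx m) (Idx m) ℝ) (j h : Idx m) :
    (Bᵀ * S * B) j h = ∑ p, ∑ q, B p j * B q h * S p q := by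
  simp only [Matrix.mul_apply, Matrix.transpose_apply, Finset.sum_mul]
  rw [Finset.sum_comm]
  refine Finset.sum_congr rfl fun p _ => Finset.sum_congr rfl fun q _ => by ring

/-- The coefficients of the eigenvalue part of the Gaussian central sequence. -/
def coefIII (i : Fin m) (p q : Idx m) (s : Param m) : ℝ :=
  gaussConst m / 2 * (s.scaleSq⁻¹ * (s.eigTail i)⁻¹ *
    ((s.eigTail i)⁻¹ * (s.beta p i.succ * s.beta q i.succ)
      - (s.eig 0)⁻¹ * (s.beta p 0 * s.beta q 0)))

/-- The coefficients of the eigenvector part of the Gaussian central sequence. -/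
def coefIV (r : Idx m × Idx m) (p q : Idx m) (s : Param m) : ℝ :=
  gaussConst m / 2 * ∑ w : UpperPair m, s.scaleSq⁻¹ * Gmat s r w *
    ((s.eig w.1.2)⁻¹ - (s.eig w.1.1)⁻¹) * (s.beta p w.1.1 * s.beta q w.1.2)

lemma sum_coefIII (i : Fin m) (s : Param m) (S : Matrix (Idx m) (Idx m) ℝ) :
    ∑ p, ∑ q, coefIII i p q s * S p q = gaussConst m / 2 * (s.scaleSq⁻¹ * (s.eigTail i)⁻¹ *
      ((s.eigTail i)⁻¹ * (s.betaᵀ * S * s.beta) i.succ i.succ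
        - (s.eig 0)⁻¹ * (s.betaᵀ * S * s.beta) 0 0)) := by
  simp only [transpose_mul_mul_apply, Finset.mul_sum, ← Finset.sum_sub_distrib, coefIII]
  refine Finset.sum_congr rfl fun p _ => Finset.sum_congr rfl fun q _ => by ring

lemma sum_coefIV (r : Idx m × Idx m) (s : Param m) (S : Matrix (Idx m) (Idx m) ℝ) :
    ∑ p, ∑ q, coefIV r p q s * S p q = gaussConst m / 2 * ∑ w : UpperPair m,
      s.scaleSq⁻¹ * Gmat s r w * ((s.eig w.1.2)⁻¹ - (s.eig w.1.1)⁻¹) *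
        (s.betaᵀ * S * s.beta) w.1.1 w.1.2 := by
  simp only [transpose_mul_mul_apply, Finset.mul_sum, coefIV, Finset.sum_mul]
  rw [Finset.sum_comm]
  simp_rw [Finset.sum_comm (s := (Finset.univ : Finset (UpperPair m)))]
  rw [Finset.sum_comm]
  refine Finset.sum_congr rfl fun p _ => Finset.sum_congr rfl fun q _ =>
    Finset.sum_congr rfl fun w _ => by ring

/-- This is `1/√n = √n/n`; at `n = 0` both sides are `0` by the conventions for division. -/
lemma one_div_two_mul_sqrt (n : ℕ) (c y : ℝ) :
    1 / (2 * Real.sqrt n) * (c * y) = Real.sqrt n * (c / 2 * ((n : ℝ)⁻¹ * y)) := by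
  rcases n.eq_zero_or_pos with rfl | hn
  · simp
  · have h0 : (0 : ℝ) < n := by exact_mod_cast hn
    have h1 : Real.sqrt n ≠ 0 := (Real.sqrt_pos.2 h0).ne'
    have h2 : Real.sqrt n * Real.sqrt n = n := Real.mul_self_sqrt h0.le
    nth_rw 3 [← h2]
    field_simp

/-- Since `β'β = I`, `Λ^{-1/2}β'V^{-1/2} = Λ⁻¹β'`. The Kronecker product thus produces
`Λ⁻¹(β'Sβ)Λ⁻¹`, of which `Hmat` keeps the diagonal and `Mmat` takes differences against the first
entry. -/
lemma centralIII_phi1 {s : Param m} (hs : s ∈ ParamSpace m) {n : ℕ} (x : Fin n → Idx m → ℝ)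
    (i : Fin m) : centralIII s (phi1 m) x i =
      Real.sqrt n * ∑ p, ∑ q, coefIII i p q s * scatterMean s.loc x p q := by
  set S : Matrix (Idx m) (Idx m) ℝ := ∑ i, Matrix.vecMulVec (x i - s.loc) (x i - s.loc) with hS
  set D : Matrix (Idx m) (Idx m) ℝ := Matrix.diagonal (fun j => (s.eig j)⁻¹) with hD
  set R : Matrix (Idx m) (Idx m) ℝ := Matrix.diagonal (fun j => (Real.sqrt (s.eig j))⁻¹) with hR
  have hRR : R * R = D := rootInv_mul_rootInv hs
  have hAW : R * s.betaᵀ * s.shapeInvSqrt = D * s.betaᵀ := by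
    rw [Param.shapeInvSqrt, ← hR, ← hRR]
    calc _ = R * (s.betaᵀ * s.beta) * R * s.betaᵀ := by simp only [Matrix.mul_assoc]
      _ = _ := by rw [transpose_beta_mul_beta hs, Matrix.mul_one]
  have hX : R * s.betaᵀ * (s.shapeInvSqrt * S * s.shapeInvSqrtᵀ) * (R * s.betaᵀ)ᵀ
      = D * (s.betaᵀ * S * s.beta) * D := by
    calc _ = (R * s.betaᵀ * s.shapeInvSqrt) * S * (R * s.betaᵀ * s.shapeInvSqrt)ᵀ := by
          simp only [Matrix.transpose_mul, Matrix.mul_assoc]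
      _ = _ := by
          rw [hAW, Matrix.transpose_mul, Matrix.transpose_transpose, hD,
            Matrix.diagonal_transpose]
          simp only [Matrix.mul_assoc]
  have hE : ∀ j, (D * (s.betaᵀ * S * s.beta) * D) j j
      = (s.eig j)⁻¹ * (s.betaᵀ * S * s.beta) j j * (s.eig j)⁻¹ := fun j => by
    rw [hD, Matrix.mul_diagonal, Matrix.diagonal_mul]
  have h1 : s.eig i.succ = s.eigTail i := by simp [Param.eig]
  have h0 : s.eig 0 ≠ 0 := (hs.2.2.1 0).ne'
  have hi : s.eigTail i ≠ 0 := h1 ▸ (hs.2.2.1 i.succ).ne'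
  rw [centralIII, scoreSum_phi1 hs, ← hS, ← hR, ← Matrix.mulVec_mulVec, ← Matrix.mulVec_mulVec,
    Matrix.kronecker_mulVec_vec, Matrix.mul_smul, Matrix.smul_mul, hX, Hmat_mulVec_vec,
    Pi.smul_apply, mulVec_Mmat, sum_coefIII]
  simp only [Matrix.diag_apply, Matrix.smul_apply, smul_eq_mul, hE, h1, scatterMean, ← hS,
    Matrix.mul_smul, Matrix.smul_mul]
  have := one_div_two_mul_sqrt n (gaussConst m) (s.scaleSq⁻¹ * (s.eigTail i)⁻¹ *
      ((s.eigTail i)⁻¹ * (s.betaᵀ * S * s.beta) i.succ i.succ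
        - (s.eig 0)⁻¹ * (s.betaᵀ * S * s.beta) 0 0))
  calc _ = _ := by
        field_simp
      _ = _ := this
      _ = _ := by ring

/-- As `vec` stacks columns, the first Kronecker index is the column index, so `β_h ⊗ β_j` extracts
the entry `(j, h)`. -/
lemma mulVec_Lmat_vec (s : Param m) (X : Matrix (Idx m) (Idx m) ℝ) (w : UpperPair m) :
    (Lmat s *ᵥ X.vec) w = (s.eig w.1.1 - s.eig w.1.2) * (s.betaᵀ * X * s.beta) w.1.1 w.1.2 := by
  rw [transpose_mul_mul_apply, Finset.mul_sum]
  simp only [Matrix.mulVec, dotProduct, Lmat, Matrix.of_apply, Matrix.vec, Fintype.sum_prod_type]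
  rw [Finset.sum_comm]
  refine Finset.sum_congr rfl fun p _ => ?_
  rw [Finset.mul_sum]
  refine Finset.sum_congr rfl fun q _ => by ring

lemma centralIV_phi1 {s : Param m} (hs : s ∈ ParamSpace m) {n : ℕ} (x : Fin n → Idx m → ℝ)
    (r : Idx m × Idx m) : centralIV s (phi1 m) x r =
      Real.sqrt n * ∑ p, ∑ q, coefIV r p q s * scatterMean s.loc x p q := by
  set S : Matrix (Idx m) (Idx m) ℝ := ∑ i, Matrix.vecMulVec (x i - s.loc) (x i - s.loc) with hS
  set D : Matrix (Idx m) (Idx m) ℝ := Matrix.diagonal (fun j => (s.eig j)⁻¹) with hD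
  set W := s.shapeInvSqrt with hW
  have hbb := transpose_beta_mul_beta hs
  have hWW : W * W = s.beta * D * s.betaᵀ := by
    rw [hW, Param.shapeInvSqrt, hD, ← rootInv_mul_rootInv hs]
    set R : Matrix (Idx m) (Idx m) ℝ := Matrix.diagonal (fun j => (Real.sqrt (s.eig j))⁻¹)
    calc _ = s.beta * R * (s.betaᵀ * s.beta) * R * s.betaᵀ := by simp only [Matrix.mul_assoc]
      _ = _ := by rw [hbb, Matrix.mul_one]; simp only [Matrix.mul_assoc]
  -- One pair of roots comes from the standardized observations and one from the definition of the
  -- central sequence; together they give `V⁻¹SV⁻¹`, which the eigenbasis diagonalizes on both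
  -- sides.
  have hX : s.betaᵀ * (W * (W * S * W) * W) * s.beta = D * (s.betaᵀ * S * s.beta) * D := by
    calc _ = s.betaᵀ * (W * W) * S * (W * W) * s.beta := by simp only [Matrix.mul_assoc]
      _ = (s.betaᵀ * s.beta) * D * s.betaᵀ * S * s.beta * D * (s.betaᵀ * s.beta) := by
          rw [hWW]; simp only [Matrix.mul_assoc]
      _ = _ := by rw [hbb, Matrix.mul_one, Matrix.one_mul]; simp only [Matrix.mul_assoc]
  have hWt : Wᵀ = W := shapeInvSqrt_transpose s
  rw [centralIV, scoreSum_phi1 hs, ← hS, ← hW, ← Matrix.mulVec_mulVec, ← Matrix.mulVec_mulVec,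
    Matrix.kronecker_mulVec_vec, Matrix.mul_smul, Matrix.smul_mul, hWt, Pi.smul_apply, sum_coefIV]
  simp only [mulVec_apply_eq_sum (Gmat s), mulVec_Lmat_vec, Matrix.mul_smul, Matrix.smul_mul, hX, Matrix.smul_apply, smul_eq_mul,
    scatterMean, ← hS]
  simp only [Finset.mul_sum]
  refine Finset.sum_congr rfl fun w _ => ?_
  rw [hD, Matrix.mul_diagonal, Matrix.diagonal_mul]
  have h1 := (hs.2.2.1 w.1.1).ne'
  have h2 := (hs.2.2.1 w.1.2).ne'
  have := one_div_two_mul_sqrt n (gaussConst m) (s.scaleSq⁻¹ * Gmat s r w *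
    ((s.eig w.1.2)⁻¹ - (s.eig w.1.1)⁻¹) * (s.betaᵀ * S * s.beta) w.1.1 w.1.2)
  -- The factor `λ_j - λ_h` of `Lmat`, divided by `λ_j λ_h`, is the difference of inverse
  -- eigenvalues in `coefIV`.
  calc _ = _ := by
        field_simp
      _ = _ := this
      _ = _ := by ring

/-! ### The information matrices -/

lemma Kmat_apply (i j a b : Idx m) :
    Kmat m (i, j) (a, b) = if i = b ∧ j = a then 1 else 0 := by
  simp only [Kmat, Matrix.sum_apply, Matrix.kroneckerMap_apply, Matrix.single_apply]
  rw [Finset.sum_eq_single i, Finset.sum_eq_single a]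
  · by_cases h1 : i = b <;> by_cases h2 : j = a <;> simp [h1, h2, eq_comm]
  · intro c _ hc; simp [hc]
  · simp
  · intro c _ hc; simp [hc]
  · simp

lemma Hmat_mul_apply {ι : Type*} (A : Matrix (Idx m × Idx m) ι ℝ) (j : Idx m) (l : ι) :
    (Hmat m * A) j l = A (j, j) l := by
  rw [Matrix.mul_apply, Finset.sum_eq_single (j, j)]
  · simp [Hmat]
  · rintro ⟨a, b⟩ - hab
    have : ¬ (a = j ∧ b = j) := fun h => hab (Prod.ext h.1 h.2)
    simp [Hmat, this]
  · simp

/-- The rows of `Hmat` are the vectorized symmetric matrices `e_j e_j'`, which commutation fixes. So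
`I + K` acts as multiplication by `2` behind `Hmat`. -/
lemma Hmat_mul_Kmat : Hmat m * Kmat m = Hmat m := by
  ext j ⟨a, b⟩
  rw [Hmat_mul_apply, Kmat_apply, Hmat]
  simp only [Matrix.of_apply]
  congr 1
  simp only [eq_iff_iff]
  constructor <;> rintro ⟨h1, h2⟩ <;> exact ⟨h2.symm, h1.symm⟩

lemma Hmat_mul_kronecker_mul_transpose (d : Idx m → ℝ) :
    Hmat m * (Matrix.diagonal d ⊗ₖ Matrix.diagonal d) * (Hmat m)ᵀ
      = Matrix.diagonal (fun j => d j ^ 2) := by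
  ext j l
  rw [← Matrix.transpose_apply (_ * _), Matrix.transpose_mul, Matrix.transpose_transpose,
    Hmat_mul_apply, Matrix.transpose_apply, Hmat_mul_apply, Matrix.kroneckerMap_apply]
  by_cases h : j = l
  · subst h; simp [sq]
  · simp [h]

/-- The sum over `j` comes from the first column of `Mmat`, that is, from the constraint that the
eigenvalues have product one. -/
lemma infoIII_mulVec {s : Param m} (hs : s ∈ ParamSpace m) (u : Fin m → ℝ) (i : Fin m) :
    (infoIII s (phi1 m) *ᵥ u) i
      = 1 / 2 * ((s.eigTail i)⁻¹ * ((s.eigTail i)⁻¹ * u i + ∑ j, (s.eigTail j)⁻¹ * u j)) := by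
  have h0 : s.eig 0 ≠ 0 := (hs.2.2.1 0).ne'
  have hD : Dmat s = (1 / 2 : ℝ) • (Mmat s * Matrix.diagonal (fun j => (s.eig j)⁻¹ ^ 2)
      * (Mmat s)ᵀ) := by
    rw [Dmat, Matrix.mul_assoc (Mmat s), Matrix.mul_add, Matrix.mul_one, Hmat_mul_Kmat,
      ← two_smul ℝ (Hmat m), ← Hmat_mul_kronecker_mul_transpose]
    simp only [Matrix.mul_smul, Matrix.smul_mul, smul_smul, Matrix.mul_assoc]
    norm_num
  have h1 : ∀ i, s.eig i.succ = s.eigTail i := fun i => by simp [Param.eig]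
  rw [infoIII, infoJ_phi1_div, one_smul, hD, Matrix.smul_mulVec, Pi.smul_apply, smul_eq_mul,
    ← Matrix.mulVec_mulVec, ← Matrix.mulVec_mulVec, mulVec_Mmat, Matrix.mulVec_diagonal,
    Matrix.mulVec_diagonal, h1]
  have ha : ((Mmat s)ᵀ *ᵥ u) i.succ = u i := by
    simp [Matrix.mulVec, dotProduct, Mmat]
  have hb : ((Mmat s)ᵀ *ᵥ u) 0 = - s.eig 0 * ∑ j, (s.eigTail j)⁻¹ * u j := by
    simp only [Matrix.mulVec, dotProduct, Mmat, Matrix.transpose_apply, Matrix.of_apply,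
      Fin.cons_zero, Finset.mul_sum, mul_assoc]
  have hi : s.eigTail i ≠ 0 := h1 i ▸ (hs.2.2.1 i.succ).ne'
  rw [ha, hb]
  field_simp
  ring

lemma transpose_Gmat_mulVec (s : Param m) (u : Idx m × Idx m → ℝ) (w : UpperPair m) :
    ((Gmat s)ᵀ *ᵥ u) w
      = ∑ l, (s.beta l w.1.2 * u (w.1.1, l) - s.beta l w.1.1 * u (w.1.2, l)) := by
  simp only [Matrix.mulVec, dotProduct, Gmat, Matrix.transpose_apply, Matrix.of_apply,
    Fintype.sum_prod_type]
  rw [Finset.sum_comm]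
  refine Finset.sum_congr rfl fun l _ => ?_
  simp [sub_mul, Pi.single_apply, ite_mul, Finset.sum_sub_distrib]

lemma infoIV_mulVec (s : Param m) (u : Idx m × Idx m → ℝ) (r : Idx m × Idx m) :
    (infoIV s (phi1 m) *ᵥ u) r
      = 1 / 4 * ∑ w, Gmat s r w * ((nu s w)⁻¹ * ((Gmat s)ᵀ *ᵥ u) w) := by
  rw [infoIV, infoJ_phi1_div, mul_one, Matrix.smul_mulVec, Pi.smul_apply, smul_eq_mul,
    ← Matrix.mulVec_mulVec, ← Matrix.mulVec_mulVec]
  congr 1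
  simp only [mulVec_apply_eq_sum (Gmat s), Matrix.mulVec_diagonal]

/-! ### Spherical laws -/

lemma norm_toLp_eq_sqrt (z : Idx m → ℝ) : ‖WithLp.toLp 2 z‖ = Real.sqrt (z ⬝ᵥ z) := by
  rw [EuclideanSpace.norm_eq]
  simp [dotProduct, sq]

lemma integrable_radial_iff (f : ℝ → ℝ) :
    Integrable (fun z : Idx m → ℝ => f (Real.sqrt (z ⬝ᵥ z))) ↔
      IntegrableOn (fun r => r ^ m * f r) (Set.Ioi 0) := by
  have h := integrable_fun_norm_addHaar (volume : Measure (EuclideanSpace ℝ (Idx m))) (f := f)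
  rw [← (PiLp.volume_preserving_toLp (Idx m)).integrable_comp_emb
    (MeasurableEquiv.toLp 2 _).measurableEmbedding] at h
  simpa [Function.comp_def, norm_toLp_eq_sqrt] using h

/-- Polar coordinates. The constant is the same for all `f`, so it cancels in every normalized
integral and its value is never needed. -/
lemma exists_integral_radial_eq (m : ℕ) : ∃ ω : ℝ, ω ≠ 0 ∧ ∀ f : ℝ → ℝ,
    ∫ z : Idx m → ℝ, f (Real.sqrt (z ⬝ᵥ z)) = ω * ∫ r in Set.Ioi (0 : ℝ), r ^ m * f r := by
  refine ⟨(m + 1) * (volume : Measure (EuclideanSpace ℝ (Idx m))).real (Metric.ball 0 1), ?_,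
    fun f => ?_⟩
  · have : 0 < (volume : Measure (EuclideanSpace ℝ (Idx m))).real (Metric.ball 0 1) :=
      ENNReal.toReal_pos (Metric.measure_ball_pos _ _ one_pos).ne' measure_ball_lt_top.ne
    positivity
  · have h := integral_fun_norm_addHaar (volume : Measure (EuclideanSpace ℝ (Idx m))) f
    rw [← (PiLp.volume_preserving_toLp (Idx m)).integral_comp
      (MeasurableEquiv.toLp 2 _).measurableEmbedding] at h
    simp only [norm_toLp_eq_sqrt, finrank_euclideanSpace, Fintype.card_fin, nsmul_eq_mul,
      smul_eq_mul, Nat.add_sub_cancel] at h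
    rw [h]
    push_cast
    ring

/-- The spherical density with radial density `f`. -/
def sphDensity (f : ℝ → ℝ) (z : Idx m → ℝ) : ℝ :=
  (∫ z : Idx m → ℝ, f (Real.sqrt (z ⬝ᵥ z)))⁻¹ * f (Real.sqrt (z ⬝ᵥ z))

/-- The spherical law with radial density `f`. -/
def sphLaw (m : ℕ) (f : ℝ → ℝ) : Measure (Idx m → ℝ) :=
  volume.withDensity fun z => ENNReal.ofReal (sphDensity f z)

lemma continuous_sqrt_dotProduct_self :
    Continuous fun z : Idx m → ℝ => Real.sqrt (z ⬝ᵥ z) := by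
  simp only [dotProduct]
  fun_prop

lemma measurable_sphDensity {f : ℝ → ℝ} (hf : Measurable f) :
    Measurable (sphDensity f : (Idx m → ℝ) → ℝ) :=
  (hf.comp continuous_sqrt_dotProduct_self.measurable).const_mul _

lemma radialMoment_ne_zero {g : ℝ → ℝ} (hg : IsStdRadial (m + 1) g) : radialMoment m g ≠ 0 := by
  intro h
  have := hg.median
  -- A zero moment has inverse `0`, and the median condition would read `0 = 1/2`.
  simp [h] at this

/-- Only almost everywhere: the sign of `g` at `0` is unconstrained, so the origin has to be
removed. -/
lemma sphDensity_nonneg_ae {g : ℝ → ℝ} (hg : IsStdRadial (m + 1) g) :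
    ∀ᵐ z : Idx m → ℝ, 0 ≤ sphDensity g z := by
  have hae : ∀ᵐ z : Idx m → ℝ, 0 ≤ g (Real.sqrt (z ⬝ᵥ z)) := by
    have h0 : ∀ᵐ z : Idx m → ℝ, z ≠ 0 := by
      simp [ae_iff]
    filter_upwards [h0] with z hz
    refine hg.nonneg _ (Real.sqrt_pos.2 (lt_of_le_of_ne ?_ ?_))
    · exact Finset.sum_nonneg fun _ _ => mul_self_nonneg _
    · exact fun h => hz (dotProduct_self_eq_zero.1 h.symm)
  filter_upwards [hae] with z hz
  exact mul_nonneg (inv_nonneg.2 (integral_nonneg_of_ae hae)) hz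

lemma integrable_sphLaw_iff {g : ℝ → ℝ} (hg : IsStdRadial (m + 1) g) (F : (Idx m → ℝ) → ℝ) :
    Integrable F (sphLaw m g) ↔ Integrable fun z => sphDensity g z * F z := by
  rw [sphLaw, integrable_withDensity_iff_integrable_smul'
    (measurable_sphDensity hg.measurable).ennreal_ofReal (by simp)]
  refine integrable_congr ?_
  filter_upwards [sphDensity_nonneg_ae hg] with z hz
  rw [ENNReal.toReal_ofReal hz, smul_eq_mul]

lemma integral_sphLaw {g : ℝ → ℝ} (hg : IsStdRadial (m + 1) g) (F : (Idx m → ℝ) → ℝ) :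
    ∫ z, F z ∂(sphLaw m g) = ∫ z, sphDensity g z * F z := by
  rw [sphLaw, integral_withDensity_eq_integral_toReal_smul
    (measurable_sphDensity hg.measurable).ennreal_ofReal (by simp)]
  refine integral_congr_ae ?_
  filter_upwards [sphDensity_nonneg_ae hg] with z hz
  rw [ENNReal.toReal_ofReal hz, smul_eq_mul]

lemma isProbabilityMeasure_sphLaw {g : ℝ → ℝ} (hg : IsStdRadial (m + 1) g) :
    IsProbabilityMeasure (sphLaw m g) := by
  have hi : Integrable (sphDensity g : (Idx m → ℝ) → ℝ) := by
    have := (integrable_radial_iff (m := m) g).2 (by simpa using hg.integrable)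
    exact this.const_mul _
  obtain ⟨ω, hω, h⟩ := exists_integral_radial_eq m
  refine ⟨?_⟩
  rw [sphLaw, withDensity_apply _ MeasurableSet.univ, Measure.restrict_univ,
    ← ofReal_integral_eq_lintegral_ofReal hi (sphDensity_nonneg_ae hg)]
  have : ∫ z : Idx m → ℝ, sphDensity g z = 1 := by
    simp only [sphDensity]
    rw [integral_const_mul, h g]
    exact inv_mul_cancel₀ (mul_ne_zero hω (radialMoment_ne_zero hg))
  rw [this, ENNReal.ofReal_one]

lemma integral_sphLaw_radial {g : ℝ → ℝ} (hg : IsStdRadial (m + 1) g) (φ : ℝ → ℝ) :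
    ∫ z, φ (Real.sqrt (z ⬝ᵥ z)) ∂(sphLaw m g)
      = (∫ r in Set.Ioi (0 : ℝ), r ^ m * (g r * φ r)) / radialMoment m g := by
  obtain ⟨ω, hω, h⟩ := exists_integral_radial_eq m
  rw [integral_sphLaw hg]
  simp only [sphDensity, mul_assoc]
  rw [integral_const_mul, h g, h fun r => g r * φ r, radialMoment]
  have := radialMoment_ne_zero hg
  rw [radialMoment] at this
  field_simp

lemma integrable_sphLaw_radial {g : ℝ → ℝ} (hg : IsStdRadial (m + 1) g) {φ : ℝ → ℝ}
    (hφ : IntegrableOn (fun r => r ^ m * (g r * φ r)) (Set.Ioi 0)) :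
    Integrable (fun z => φ (Real.sqrt (z ⬝ᵥ z))) (sphLaw m g) := by
  rw [integrable_sphLaw_iff hg]
  have := ((integrable_radial_iff (m := m) fun r => g r * φ r).2 hφ).const_mul
    (∫ z : Idx m → ℝ, g (Real.sqrt (z ⬝ᵥ z)))⁻¹
  refine this.congr (.of_forall fun z => ?_)
  simp only [sphDensity]
  ring

/-! ### Affine images of absolutely continuous laws -/

/-- The change of variables behind both the rotation invariance of spherical laws and the
representation of elliptical laws as their affine images. -/
lemma map_affine_withDensity (θ : Idx m → ℝ) {L : Matrix (Idx m) (Idx m) ℝ} (hL : L.det ≠ 0)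
    {h h' : (Idx m → ℝ) → ENNReal} (hm : Measurable h')
    (H : ∀ z, h z = ENNReal.ofReal |L.det| * h' (θ + L *ᵥ z)) :
    (volume.withDensity h).map (fun z => θ + L *ᵥ z) = volume.withDensity h' := by
  have hLm : Measurable fun z : Idx m → ℝ => L *ᵥ z :=
    (LinearMap.continuous_of_finiteDimensional (Matrix.toLin' L)).measurable
  have hT : Measurable fun z : Idx m → ℝ => θ + L *ᵥ z := hLm.const_add θ
  have hvol : (volume : Measure (Idx m → ℝ)).map (fun z => θ + L *ᵥ z)
      = ENNReal.ofReal |L.det⁻¹| • volume := by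
    have h1 := Real.map_matrix_volume_pi_eq_smul_volume_pi hL
    have h2 : (volume : Measure (Idx m → ℝ)).map (fun z => θ + L *ᵥ z)
        = ((volume : Measure (Idx m → ℝ)).map (Matrix.toLin' L)).map (fun y => θ + y) := by
      rw [Measure.map_map (measurable_const_add θ) (by exact hLm)]
      rfl
    rw [h2, h1, Measure.map_smul, map_add_left_eq_self]
  ext A hA
  rw [Measure.map_apply hT hA, withDensity_apply _ (hT hA), withDensity_apply _ hA]
  simp only [H]
  rw [← setLIntegral_map (f := fun y => ENNReal.ofReal |L.det| * h' y) hA (hm.const_mul _) hT,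
    hvol, Measure.restrict_smul, lintegral_smul_measure, lintegral_const_mul _ hm, smul_eq_mul,
    ← mul_assoc, ← ENNReal.ofReal_mul (abs_nonneg _), ← abs_mul, inv_mul_cancel₀ hL, abs_one,
    ENNReal.ofReal_one, one_mul]

lemma map_orthogonal_sphLaw {f : ℝ → ℝ} (hf : Measurable f) {O : Matrix (Idx m) (Idx m) ℝ}
    (hO : Oᵀ * O = 1) : (sphLaw m f).map (fun z => O *ᵥ z) = sphLaw m f := by
  have hdet : O.det * O.det = 1 := by
    have := congrArg Matrix.det hO
    simpa using this
  have habs : |O.det| = 1 := by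
    rw [← abs_one, ← sq_eq_sq_iff_abs_eq_abs, sq, hdet, one_pow]
  have h := map_affine_withDensity (m := m) 0 (L := O)
    (h := fun z => ENNReal.ofReal (sphDensity f z))
    (h' := fun z => ENNReal.ofReal (sphDensity f z))
    (fun h0 => by simp [h0] at hdet) (measurable_sphDensity hf).ennreal_ofReal (fun z => by
      have : (O *ᵥ z) ⬝ᵥ (O *ᵥ z) = z ⬝ᵥ z := by
        rw [Matrix.dotProduct_mulVec, Matrix.vecMul_mulVec, hO, Matrix.vecMul_one]
      simp [habs, sphDensity, this])
  simpa [sphLaw] using h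

lemma integral_sphLaw_orthogonal {f : ℝ → ℝ} (hf : Measurable f)
    {O : Matrix (Idx m) (Idx m) ℝ} (hO : Oᵀ * O = 1) {F : (Idx m → ℝ) → ℝ} (hF : Measurable F) :
    ∫ z, F (O *ᵥ z) ∂(sphLaw m f) = ∫ z, F z ∂(sphLaw m f) := by
  conv_rhs => rw [← map_orthogonal_sphLaw hf hO]
  rw [integral_map _ hF.aestronglyMeasurable]
  exact (LinearMap.continuous_of_finiteDimensional (Matrix.toLin' O)).aemeasurable

/-! ### Moments of spherical laws -/

lemma integrableOn_pow_mul_of_isStdRadial4 {g : ℝ → ℝ} (hg : IsStdRadial4 (m + 1) g) :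
    IntegrableOn (fun r => r ^ m * (g r * r ^ 4)) (Set.Ioi 0) := by
  have h := hg.fourth.const_mul (radialMoment m g)
  refine IntegrableOn.congr_fun h (fun r hr => ?_) measurableSet_Ioi
  have h0 := radialMoment_ne_zero hg.toIsStdRadial
  simp only [distDensity, if_pos (Set.mem_Ioi.1 hr), Nat.add_sub_cancel]
  field_simp

lemma integrable_sphLaw_dotProduct_sq {g : ℝ → ℝ} (hg : IsStdRadial4 (m + 1) g) :
    Integrable (fun z => (z ⬝ᵥ z) ^ 2) (sphLaw m g) := by
  refine (integrable_sphLaw_radial hg.toIsStdRadial (φ := fun r => r ^ 4)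
    (integrableOn_pow_mul_of_isStdRadial4 hg)).congr (.of_forall fun z => ?_)
  have : 0 ≤ z ⬝ᵥ z := Finset.sum_nonneg fun _ _ => mul_self_nonneg _
  simp only
  rw [show 4 = 2 * 2 from rfl, pow_mul, Real.sq_sqrt this]

lemma sq_le_dotProduct_self (z : Idx m → ℝ) (a : Idx m) : z a ^ 2 ≤ z ⬝ᵥ z := by
  rw [sq]
  exact Finset.single_le_sum (f := fun a => z a * z a) (fun _ _ => mul_self_nonneg _)
    (Finset.mem_univ a)

/-- `(z_a z_b)² ≤ ‖z‖⁴`: the fourth radial moment gives the products the finite variance required by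
Chebyshev's inequality. -/
lemma memLp_mul_sphLaw {g : ℝ → ℝ} (hg : IsStdRadial4 (m + 1) g) (a b : Idx m) :
    MemLp (fun z => z a * z b) 2 (sphLaw m g) := by
  rw [memLp_two_iff_integrable_sq (by fun_prop)]
  refine (integrable_sphLaw_dotProduct_sq hg).mono' (by fun_prop) (.of_forall fun z => ?_)
  have h1 := sq_le_dotProduct_self z a
  have h2 := sq_le_dotProduct_self z b
  rw [Real.norm_of_nonneg (sq_nonneg _), mul_pow, sq (z ⬝ᵥ z)]
  exact mul_le_mul h1 h2 (sq_nonneg _) ((sq_nonneg _).trans h1)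

lemma memLp_eval_sphLaw {g : ℝ → ℝ} (hg : IsStdRadial4 (m + 1) g) (a : Idx m) :
    MemLp (fun z => z a) 2 (sphLaw m g) := by
  have := isProbabilityMeasure_sphLaw hg.toIsStdRadial
  rw [memLp_two_iff_integrable_sq (measurable_pi_apply a).aestronglyMeasurable]
  refine ((memLp_mul_sphLaw hg a a).integrable (by norm_num)).congr (.of_forall fun z => ?_)
  simp only [sq]

lemma integral_eval_sphLaw {g : ℝ → ℝ} (hg : Measurable g) (a : Idx m) :
    ∫ z, z a ∂(sphLaw m g) = 0 := by
  have h := integral_sphLaw_orthogonal (m := m) hg (O := -1) (by simp) (measurable_pi_apply a)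
  simp only [Matrix.neg_mulVec, Matrix.one_mulVec, Pi.neg_apply, integral_neg] at h
  linarith

lemma integral_mul_sphLaw_of_ne {g : ℝ → ℝ} (hg : Measurable g) {a b : Idx m} (hab : a ≠ b) :
    ∫ z, z a * z b ∂(sphLaw m g) = 0 := by
  have h := integral_sphLaw_orthogonal (m := m) hg
    -- Reflecting the single coordinate `a` changes the sign of `z_a z_b`.
    (O := Matrix.diagonal (Function.update 1 a (-1))) (by
      rw [Matrix.diagonal_transpose, Matrix.diagonal_mul_diagonal, ← Matrix.diagonal_one]
      congr 1
      funext i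
      by_cases hi : i = a
      · subst hi; simp
      · simp [hi]) ((measurable_pi_apply a).mul (measurable_pi_apply b))
  simp [Matrix.mulVec_diagonal, hab.symm, integral_neg] at h
  linarith

lemma integral_sq_sphLaw_eq {g : ℝ → ℝ} (hg : Measurable g) (a b : Idx m) :
    ∫ z, z a * z a ∂(sphLaw m g) = ∫ z, z b * z b ∂(sphLaw m g) := by
  have h := integral_sphLaw_orthogonal (m := m) hg
    (O := (Equiv.swap b a).permMatrix ℝ) (by
      rw [Matrix.transpose_permMatrix, ← Matrix.permMatrix_mul]
      simp) ((measurable_pi_apply b).mul (measurable_pi_apply b))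
  simpa [Matrix.permMatrix_mulVec] using h

/-- Reflections kill the off-diagonal moments and transpositions equate the diagonal ones; their
total is `E‖z‖² = μ_{k+1}/μ_{k-1}`. -/
lemma integral_mul_sphLaw {g : ℝ → ℝ} (hg : IsStdRadial4 (m + 1) g) (a b : Idx m) :
    ∫ z, z a * z b ∂(sphLaw m g) = if a = b then Dconst (m + 1) g / (m + 1) else 0 := by
  have hp := isProbabilityMeasure_sphLaw hg.toIsStdRadial
  by_cases hab : a = b
  · subst hab
    rw [if_pos rfl]
    have h1 : ∫ z, z ⬝ᵥ z ∂(sphLaw m g) = Dconst (m + 1) g := by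
      have := integral_sphLaw_radial hg.toIsStdRadial fun r => r ^ 2
      rw [Dconst]
      convert! this using 2
      · funext z
        exact (Real.sq_sqrt (Finset.sum_nonneg fun _ _ => mul_self_nonneg _)).symm
      · rw [radialMoment]
        congr 1
        funext r
        ring
    have h2 : ∫ z, z ⬝ᵥ z ∂(sphLaw m g) = (m + 1) * ∫ z, z a * z a ∂(sphLaw m g) := by
      simp only [dotProduct]
      rw [integral_finsetSum _ fun b _ => (memLp_mul_sphLaw hg b b).integrable (by norm_num),
        Finset.sum_congr rfl fun b _ => integral_sq_sphLaw_eq hg.measurable b a]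
      simp
    rw [← h1, h2]
    field_simp
  · rw [if_neg hab, integral_mul_sphLaw_of_ne hg.measurable hab]

/-! ### Moments of elliptical laws -/

/-- A square root of the scatter matrix. -/
def scatterRoot (t : Param m) : Matrix (Idx m) (Idx m) ℝ :=
  t.scale • (t.beta * Matrix.diagonal fun j => Real.sqrt (t.eig j))

lemma scatterRoot_mul_transpose {t : Param m} (ht : t ∈ ParamSpace m) :
    scatterRoot t * (scatterRoot t)ᵀ = t.scatter := by
  have hsc : t.scale * t.scale = t.scaleSq := Real.mul_self_sqrt ht.1.le
  have hd : Matrix.diagonal (fun j => Real.sqrt (t.eig j)) *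
      Matrix.diagonal (fun j => Real.sqrt (t.eig j)) = Matrix.diagonal t.eig := by
    rw [Matrix.diagonal_mul_diagonal]
    congr 1
    funext j
    exact Real.mul_self_sqrt (ht.2.2.1 j).le
  rw [scatterRoot, Param.scatter, Param.shape, Matrix.transpose_smul, Matrix.smul_mul,
    Matrix.mul_smul, smul_smul, hsc, Matrix.transpose_mul, Matrix.diagonal_transpose, ← hd]
  simp only [Matrix.mul_assoc]

lemma det_scatterRoot_ne_zero {t : Param m} (ht : t ∈ ParamSpace m) :
    (scatterRoot t).det ≠ 0 := by
  have hb : t.beta.det ≠ 0 := by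
    intro h
    have := congrArg Matrix.det (transpose_beta_mul_beta ht)
    simp [h] at this
  have hs : t.scale ≠ 0 := (Real.sqrt_pos.2 ht.1).ne'
  rw [scatterRoot, Matrix.det_smul, Matrix.det_mul, Matrix.det_diagonal]
  refine mul_ne_zero (pow_ne_zero _ hs) (mul_ne_zero hb (Finset.prod_ne_zero_iff.2 fun j _ => ?_))
  exact (Real.sqrt_pos.2 (ht.2.2.1 j)).ne'

/-- If `LL' = Σ`, then `x = θ + Lz` turns the quadratic form into `‖z‖²`, and the Jacobian `|det L|`
cancels the factor `|Σ|^{-1/2}`. -/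
lemma obsLaw_eq_map {t : Param m} (ht : t ∈ ParamSpace m) {f : ℝ → ℝ} (hf : Measurable f) :
    obsLaw t f = (sphLaw m f).map fun z => t.loc + scatterRoot t *ᵥ z := by
  set L := scatterRoot t with hLdef
  have hL := det_scatterRoot_ne_zero ht
  have hLL := scatterRoot_mul_transpose ht
  rw [← hLdef] at hL hLL
  have hLu : IsUnit L.det := isUnit_iff_ne_zero.2 hL
  refine (map_affine_withDensity t.loc hL (Measurable.ennreal_ofReal ?_) fun z => ?_).symm
  · have hc : Continuous fun x : Idx m → ℝ =>
        Real.sqrt ((x - t.loc) ⬝ᵥ t.scatter⁻¹ *ᵥ (x - t.loc)) := by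
      simp only [dotProduct, Matrix.mulVec]
      fun_prop
    exact (hf.comp hc.measurable).const_mul _
  · have hq : (L *ᵥ z) ⬝ᵥ t.scatter⁻¹ *ᵥ (L *ᵥ z) = z ⬝ᵥ z := by
      rw [← hLL, Matrix.mul_inv_rev, Matrix.mulVec_mulVec, Matrix.mul_assoc,
        Matrix.nonsing_inv_mul _ hLu, Matrix.mul_one, ← Matrix.vecMul_transpose,
        ← Matrix.dotProduct_mulVec, Matrix.mulVec_mulVec,
        Matrix.mul_nonsing_inv _ (by rwa [Matrix.det_transpose]), Matrix.one_mulVec]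
    have hdet : Real.sqrt t.scatter.det = |L.det| := by
      rw [← hLL, Matrix.det_mul, Matrix.det_transpose, Real.sqrt_mul_self_eq_abs]
    rw [← ENNReal.ofReal_mul (abs_nonneg _), ellDensity, add_sub_cancel_left, hq, hdet, sphDensity]
    congr 1
    have := abs_ne_zero.2 hL
    field_simp

lemma measurable_scatterRoot_affine (t : Param m) :
    Measurable fun z => t.loc + scatterRoot t *ᵥ z :=
  (LinearMap.continuous_of_finiteDimensional (Matrix.toLin' (scatterRoot t))).measurable.const_add _

lemma isProbabilityMeasure_obsLaw {t : Param m} (ht : t ∈ ParamSpace m) {g : ℝ → ℝ}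
    (hg : IsStdRadial (m + 1) g) : IsProbabilityMeasure (obsLaw t g) := by
  have := isProbabilityMeasure_sphLaw hg
  rw [obsLaw_eq_map ht hg.measurable]
  exact Measure.isProbabilityMeasure_map (measurable_scatterRoot_affine t).aemeasurable

lemma memLp_centered_obsLaw {t : Param m} (ht : t ∈ ParamSpace m) {g : ℝ → ℝ}
    (hg : IsStdRadial4 (m + 1) g) (p : Idx m) :
    MemLp (fun x => x p - t.loc p) 2 (obsLaw t g) := by
  rw [obsLaw_eq_map ht hg.measurable, memLp_map_measure_iff
    ((measurable_pi_apply p).sub_const _).aestronglyMeasurable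
    (measurable_scatterRoot_affine t).aemeasurable]
  have : MemLp (fun z => ∑ a, scatterRoot t p a * z a) 2 (sphLaw m g) :=
    memLp_finsetSum _ fun a _ => (memLp_eval_sphLaw hg a).const_mul _
  simpa [Function.comp_def, mulVec_apply_eq_sum] using this

lemma memLp_centered_mul_obsLaw {t : Param m} (ht : t ∈ ParamSpace m) {g : ℝ → ℝ}
    (hg : IsStdRadial4 (m + 1) g) (p q : Idx m) :
    MemLp (fun x => (x p - t.loc p) * (x q - t.loc q)) 2 (obsLaw t g) := by
  rw [obsLaw_eq_map ht hg.measurable, memLp_map_measure_iff (by fun_prop)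
    (measurable_scatterRoot_affine t).aemeasurable]
  have : MemLp (fun z => ∑ a, ∑ b, scatterRoot t p a * scatterRoot t q b * (z a * z b)) 2
      (sphLaw m g) :=
    memLp_finsetSum _ fun a _ => memLp_finsetSum _ fun b _ =>
      (memLp_mul_sphLaw hg a b).const_mul _
  refine this.ae_eq (.of_forall fun z => ?_)
  simp only [Function.comp_def, mulVec_apply_eq_sum, Pi.add_apply, add_sub_cancel_left,
    Finset.sum_mul_sum]
  refine Finset.sum_congr rfl fun a _ => Finset.sum_congr rfl fun b _ => by ring

lemma integral_centered_obsLaw {t : Param m} (ht : t ∈ ParamSpace m) {g : ℝ → ℝ}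
    (hg : IsStdRadial4 (m + 1) g) (p : Idx m) :
    ∫ x, (x p - t.loc p) ∂(obsLaw t g) = 0 := by
  have := isProbabilityMeasure_sphLaw hg.toIsStdRadial
  rw [obsLaw_eq_map ht hg.measurable, integral_map (measurable_scatterRoot_affine t).aemeasurable
    ((measurable_pi_apply p).sub_const _).aestronglyMeasurable]
  simp only [Pi.add_apply, add_sub_cancel_left, mulVec_apply_eq_sum]
  rw [integral_finsetSum _ fun a _ =>
    ((memLp_eval_sphLaw hg a).integrable (by norm_num)).const_mul _]
  simp [integral_const_mul, integral_eval_sphLaw hg.measurable]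

lemma integral_centered_mul_obsLaw {t : Param m} (ht : t ∈ ParamSpace m) {g : ℝ → ℝ}
    (hg : IsStdRadial4 (m + 1) g) (p q : Idx m) :
    ∫ x, (x p - t.loc p) * (x q - t.loc q) ∂(obsLaw t g)
      = Dconst (m + 1) g / (m + 1) * t.scatter p q := by
  have := isProbabilityMeasure_sphLaw hg.toIsStdRadial
  have hi : ∀ a b, Integrable (fun z => scatterRoot t p a * scatterRoot t q b * (z a * z b))
      (sphLaw m g) := fun a b => ((memLp_mul_sphLaw hg a b).integrable (by norm_num)).const_mul _
  rw [obsLaw_eq_map ht hg.measurable, integral_map (measurable_scatterRoot_affine t).aemeasurable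
    (by fun_prop)]
  have h : ∀ z : Idx m → ℝ, ((t.loc + scatterRoot t *ᵥ z) p - t.loc p) *
      ((t.loc + scatterRoot t *ᵥ z) q - t.loc q)
      = ∑ a, ∑ b, scatterRoot t p a * scatterRoot t q b * (z a * z b) := fun z => by
    simp only [mulVec_apply_eq_sum, Pi.add_apply, add_sub_cancel_left, Finset.sum_mul_sum]
    refine Finset.sum_congr rfl fun a _ => Finset.sum_congr rfl fun b _ => by ring
  simp only [h]
  rw [integral_finsetSum _ fun a _ => integrable_finsetSum _ fun b _ => hi a b]
  simp_rw [integral_finsetSum _ fun b _ => hi _ b, integral_const_mul, integral_mul_sphLaw hg]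
  rw [← scatterRoot_mul_transpose ht, Matrix.mul_apply, Finset.mul_sum]
  refine Finset.sum_congr rfl fun a _ => ?_
  simp only [mul_ite, mul_zero, Finset.sum_ite_eq, Finset.mem_univ, if_true,
    Matrix.transpose_apply]
  ring

/-! ### The weak law of large numbers for product measures -/

/-- Chebyshev's inequality on each product space separately: the samples of different sizes live on
different spaces, and only the measures of the bad events are compared. -/
lemma tendsto_measure_pi_mean {E : Type*} [MeasurableSpace E] (μ : Measure E)
    [IsProbabilityMeasure μ] {f : E → ℝ} (hf : MemLp f 2 μ) {ρ : ℝ} (hρ : 0 < ρ) :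
    Tendsto (fun n : ℕ => Measure.pi (fun _ : Fin n => μ)
      {x | ρ ≤ |(n : ℝ)⁻¹ * ∑ i, f (x i) - ∫ y, f y ∂μ|}) atTop (𝓝 0) := by
  have hlim : Tendsto (fun n : ℕ => ENNReal.ofReal
      (ProbabilityTheory.variance f μ / ρ ^ 2 * (n : ℝ)⁻¹)) atTop (𝓝 0) := by
    have h := (tendsto_inv_atTop_nhds_zero_nat (𝕜 := ℝ)).const_mul
      (ProbabilityTheory.variance f μ / ρ ^ 2)
    rw [mul_zero] at h
    simpa using ENNReal.tendsto_ofReal h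
  refine tendsto_of_tendsto_of_tendsto_of_le_of_le' tendsto_const_nhds hlim
    (.of_forall fun _ => zero_le) ?_
  filter_upwards [eventually_gt_atTop 0] with n hn
  have hn0 : (0 : ℝ) < n := by exact_mod_cast hn
  set P := Measure.pi (fun _ : Fin n => μ)
  have hLp : ∀ i : Fin n, MemLp (fun x : Fin n → E => f (x i)) 2 P := fun i =>
    hf.comp_measurePreserving (measurePreserving_eval _ i)
  have hS : MemLp (∑ i : Fin n, fun x : Fin n → E => f (x i)) 2 P :=
    memLp_finsetSum' _ fun i _ => hLp i
  have hmean : ∫ x, (∑ i : Fin n, fun x : Fin n → E => f (x i)) x ∂P = n * ∫ y, f y ∂μ := by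
    simp only [Finset.sum_apply]
    rw [integral_finsetSum _ fun i _ => (hLp i).integrable (by norm_num)]
    simp only [P, integral_comp_eval (μ := fun _ : Fin n => μ) hf.1]
    simp
  have hvar : ProbabilityTheory.variance (∑ i : Fin n, fun x : Fin n → E => f (x i)) P
      = n * ProbabilityTheory.variance f μ := by
    have := ProbabilityTheory.variance_sum_pi (μ := fun _ : Fin n => μ) (X := fun _ => f)
      fun _ => hf
    simpa using this
  have hch := ProbabilityTheory.meas_ge_le_variance_div_sq hS (c := n * ρ) (by positivity)
  rw [hmean, hvar] at hch
  have hset : {x : Fin n → E | ρ ≤ |(n : ℝ)⁻¹ * ∑ i, f (x i) - ∫ y, f y ∂μ|}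
      = {x | n * ρ ≤ |(∑ i : Fin n, fun x : Fin n → E => f (x i)) x - n * ∫ y, f y ∂μ|} := by
    ext x
    simp only [Set.mem_ofPred_eq, Finset.sum_apply]
    have : ∑ i, f (x i) - n * ∫ y, f y ∂μ
        = n * ((n : ℝ)⁻¹ * ∑ i, f (x i) - ∫ y, f y ∂μ) := by field_simp
    rw [this, abs_mul, abs_of_pos hn0, mul_le_mul_iff_right₀ hn0]
  rw [hset]
  refine hch.trans (le_of_eq ?_)
  congr 1
  field_simp

/-! ### Regularity in the parameter -/

lemma Param.eig_zero (s : Param m) : s.eig 0 = ∏ j, (s.eigTail j)⁻¹ := by simp [Param.eig]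

lemma Param.eig_succ (s : Param m) (i : Fin m) : s.eig i.succ = s.eigTail i := by
  simp [Param.eig]

lemma differentiable_scaleSq : Differentiable ℝ fun s : Param m => s.scaleSq := by
  simp only [Param.scaleSq]; fun_prop

lemma differentiable_eigTail (i : Fin m) : Differentiable ℝ fun s : Param m => s.eigTail i := by
  simp only [Param.eigTail]; fun_prop

lemma differentiable_loc (p : Idx m) : Differentiable ℝ fun s : Param m => s.loc p := by
  simp only [Param.loc]; fun_prop

lemma differentiable_beta (p q : Idx m) : Differentiable ℝ fun s : Param m => s.beta p q := by
  simp only [Param.beta, Param.vecBeta, Matrix.of_apply]; fun_prop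

lemma eigTail_ne_zero {t : Param m} (ht : t ∈ ParamSpace m) (i : Fin m) : t.eigTail i ≠ 0 :=
  t.eig_succ i ▸ (ht.2.2.1 i.succ).ne'

lemma differentiableAt_eig {t : Param m} (ht : t ∈ ParamSpace m) (j : Idx m) :
    DifferentiableAt ℝ (fun s : Param m => s.eig j) t := by
  refine Fin.cases ?_ (fun i => ?_) j
  · simp only [Param.eig_zero]
    exact (HasFDerivAt.finsetProd fun i _ => ((differentiable_eigTail i t).fun_inv
      (eigTail_ne_zero ht i)).hasFDerivAt).differentiableAt
  · simp only [Param.eig_succ]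
    exact differentiable_eigTail i t

lemma differentiable_Gmat (r : Idx m × Idx m) (w : UpperPair m) :
    Differentiable ℝ fun s : Param m => Gmat s r w := by
  simp only [Gmat, Matrix.of_apply]
  exact ((differentiable_beta _ _).const_mul _).sub ((differentiable_beta _ _).const_mul _)

lemma differentiableAt_coefIII {t : Param m} (ht : t ∈ ParamSpace m) (i : Fin m) (p q : Idx m) :
    DifferentiableAt ℝ (coefIII i p q) t := by
  have h1 := (differentiable_scaleSq t).fun_inv ht.1.ne'
  have h2 := (differentiable_eigTail i t).fun_inv (eigTail_ne_zero ht i)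
  have h3 := (differentiableAt_eig ht 0).fun_inv (ht.2.2.1 0).ne'
  have hb := fun a b => differentiable_beta (m := m) a b t
  exact (((h1.mul h2).mul ((h2.mul ((hb _ _).mul (hb _ _))).sub
    (h3.mul ((hb _ _).mul (hb _ _))))).const_mul _)

lemma differentiableAt_coefIV {t : Param m} (ht : t ∈ ParamSpace m) (r : Idx m × Idx m)
    (p q : Idx m) : DifferentiableAt ℝ (coefIV r p q) t := by
  have h1 := (differentiable_scaleSq t).fun_inv ht.1.ne'
  have h3 := fun j => (differentiableAt_eig ht j).fun_inv (ht.2.2.1 j).ne'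
  have hb := fun a b => differentiable_beta (m := m) a b t
  exact DifferentiableAt.const_mul (DifferentiableAt.fun_sum fun w _ =>
    ((h1.mul (differentiable_Gmat r w t)).mul ((h3 _).sub (h3 _))).mul ((hb _ _).mul (hb _ _))) _

/-! ### The linearization remainder -/

lemma isLittleO_of_isBigO_one_mul {α : Type*} {l : Filter α} {f g u : α → ℝ}
    (hf : f =O[l] fun _ => (1 : ℝ)) (hg : g =o[l] u) : (fun a => f a * g a) =o[l] u := by
  simpa using hf.mul_isLittleO hg

lemma isLittleO_of_isBigO_mul_one {α : Type*} {l : Filter α} {f g u : α → ℝ}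
    (hf : f =O[l] u) (hg : g =o[l] fun _ => (1 : ℝ)) : (fun a => f a * g a) =o[l] u := by
  simpa using hf.mul_isLittleO hg

lemma DifferentiableAt.sub_isBigO_norm {t : Param m} {f : Param m → ℝ}
    (hf : DifferentiableAt ℝ f t) :
    (fun s => f s - f t) =O[𝓝 t] fun s => ‖s - t‖ :=
  hf.isBigO_sub.norm_right

/-- The point `y = (s, S, b)` stands for the estimate, the empirical scatter about the true location
and the mean deviation; the bracket is the recentred scatter. Every error term is an increment of
order `‖s - t‖` times a factor tending to `0`. Stating this along a product filter makes the
estimate uniform, hence applicable at random points. -/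
lemma isLittleO_linearization {t : Param m} {l : Filter (Param m)} (hl : l ≤ 𝓝 t)
    {c : Idx m → Idx m → Param m → ℝ} (hc : ∀ p q, DifferentiableAt ℝ (c p q) t)
    (C : Idx m → Idx m → ℝ) {ℓ : Param m → ℝ}
    (hℓ : (fun s => ∑ p, ∑ q, (c p q s - c p q t) * C p q + ℓ s) =o[l] fun s => ‖s - t‖) :
    (fun y : Param m × (Idx m → Idx m → ℝ) × (Idx m → ℝ) =>
      ∑ p, ∑ q, c p q y.1 * (y.2.1 p q - y.2.2 p * (y.1.loc q - t.loc q)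
        - (y.1.loc p - t.loc p) * y.2.2 q + (y.1.loc p - t.loc p) * (y.1.loc q - t.loc q))
      - ∑ p, ∑ q, c p q t * y.2.1 p q + ℓ y.1)
      =o[l ×ˢ 𝓝 C ×ˢ 𝓝 0] fun y => ‖y.1 - t‖ := by
  set F := l ×ˢ 𝓝 C ×ˢ 𝓝 (0 : Idx m → ℝ) with hF
  have t1 : Tendsto Prod.fst F l := tendsto_fst
  have t1' : Tendsto Prod.fst F (𝓝 t) := t1.mono_right hl
  have t2 : Tendsto (fun y => y.2.1) F (𝓝 C) := tendsto_fst.comp tendsto_snd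
  have t3 : Tendsto (fun y => y.2.2) F (𝓝 0) := tendsto_snd.comp tendsto_snd
  have hS : ∀ p q, (fun y : Param m × (Idx m → Idx m → ℝ) × (Idx m → ℝ) => y.2.1 p q - C p q)
      =o[F] fun _ => (1 : ℝ) := fun p q => by
    rw [isLittleO_one_iff]
    have h := ((((continuous_apply q).comp (continuous_apply p)).tendsto C).comp t2).sub_const
      (C p q)
    simpa using h
  have hb : ∀ p, (fun y : Param m × (Idx m → Idx m → ℝ) × (Idx m → ℝ) => y.2.2 p)
      =o[F] fun _ => (1 : ℝ) := fun p => by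
    rw [isLittleO_one_iff]
    exact ((continuous_apply p).tendsto (0 : Idx m → ℝ)).comp t3
  have hv : ∀ p, (fun y : Param m × (Idx m → Idx m → ℝ) × (Idx m → ℝ) =>
      y.1.loc p - t.loc p) =O[F] fun y => ‖y.1 - t‖ := fun p =>
    (DifferentiableAt.sub_isBigO_norm (differentiable_loc p t)).comp_tendsto t1'
  have hv0 : ∀ p, (fun y : Param m × (Idx m → Idx m → ℝ) × (Idx m → ℝ) =>
      y.1.loc p - t.loc p) =o[F] fun _ => (1 : ℝ) := fun p => by
    rw [isLittleO_one_iff]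
    have h := (((differentiable_loc p).continuous.tendsto t).comp t1').sub_const (t.loc p)
    simpa using h
  have hd : ∀ p q, (fun y : Param m × (Idx m → Idx m → ℝ) × (Idx m → ℝ) =>
      c p q y.1 - c p q t) =O[F] fun y => ‖y.1 - t‖ := fun p q =>
    (DifferentiableAt.sub_isBigO_norm (hc p q)).comp_tendsto t1'
  have hc1 : ∀ p q, (fun y : Param m × (Idx m → Idx m → ℝ) × (Idx m → ℝ) => c p q y.1)
      =O[F] fun _ => (1 : ℝ) := fun p q =>
    (((hc p q).continuousAt.tendsto).comp t1').isBigO_one ℝ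
  have hA : (fun y : Param m × (Idx m → Idx m → ℝ) × (Idx m → ℝ) =>
      ∑ p, ∑ q, (c p q y.1 - c p q t) * (y.2.1 p q - C p q)) =o[F] fun y => ‖y.1 - t‖ :=
    IsLittleO.fun_sum fun p _ => IsLittleO.fun_sum fun q _ =>
      isLittleO_of_isBigO_mul_one (hd p q) (hS p q)
  have hB : (fun y : Param m × (Idx m → Idx m → ℝ) × (Idx m → ℝ) =>
      ∑ p, ∑ q, c p q y.1 * (- ((y.1.loc q - t.loc q) * y.2.2 p)
        - (y.1.loc p - t.loc p) * y.2.2 q + (y.1.loc p - t.loc p) * (y.1.loc q - t.loc q)))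
      =o[F] fun y => ‖y.1 - t‖ :=
    IsLittleO.fun_sum fun p _ => IsLittleO.fun_sum fun q _ =>
      isLittleO_of_isBigO_one_mul (hc1 p q)
        (((isLittleO_of_isBigO_mul_one (hv q) (hb p)).neg_left.sub
          (isLittleO_of_isBigO_mul_one (hv p) (hb q))).add
          (isLittleO_of_isBigO_mul_one (hv p) (hv0 q)))
  refine ((hA.add (hℓ.comp_tendsto t1)).add hB).congr_left fun y => ?_
  simp only [Function.comp_apply]
  -- Cancelling the term in `ℓ` leaves an identity that can be checked summand by summand.
  rw [show ∀ X Y Z W V : ℝ, X + (Y + W) + Z = V + W ↔ X + Y + Z = V from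
    fun X Y Z W V => ⟨fun h => by linarith, fun h => by linarith⟩]
  simp only [← Finset.sum_add_distrib, ← Finset.sum_sub_distrib]
  refine Finset.sum_congr rfl fun p _ => Finset.sum_congr rfl fun q _ => by ring

/-! ### Infinitesimal rotations -/

/-- The deviation from the identity of the rotation taking the eigenvectors of `t` to those of
`s`. -/
def rotDev (t s : Param m) : Matrix (Idx m) (Idx m) ℝ := t.betaᵀ * (s.beta - t.beta)

lemma rotDev_apply (t s : Param m) (j h : Idx m) :
    rotDev t s j h = ∑ l, t.beta l j * (s.beta l h - t.beta l h) := by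
  simp [rotDev, Matrix.mul_apply]

lemma rotDev_isBigO (t : Param m) (j h : Idx m) :
    (fun s => rotDev t s j h) =O[𝓝 t] fun s => ‖s - t‖ := by
  simp only [rotDev_apply]
  exact IsBigO.fun_sum fun l _ =>
    (DifferentiableAt.sub_isBigO_norm (differentiable_beta l h t)).const_mul_left _

lemma rotDev_isLittleO_one (t : Param m) (j h : Idx m) :
    (fun s => rotDev t s j h) =o[𝓝 t] fun _ => (1 : ℝ) := by
  refine (rotDev_isBigO t j h).trans_isLittleO ?_
  rw [isLittleO_one_iff]
  exact tendsto_norm_sub_self t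

lemma transpose_beta_shape_beta {t s : Param m} (ht : t ∈ ParamSpace m) (hs : s ∈ ParamSpace m)
    (j h : Idx m) :
    (s.betaᵀ * t.shape * s.beta) j h - (if j = h then t.eig j else 0)
        - 1 / 2 * (t.eig h - t.eig j) * (rotDev t s h j - rotDev t s j h)
      = ∑ l, (t.eig l - 1 / 2 * (t.eig h + t.eig j)) * (rotDev t s l j * rotDev t s l h) := by
  set E := rotDev t s with hE
  have hbt := transpose_beta_mul_beta ht
  have hbt' : t.beta * t.betaᵀ = 1 := mul_eq_one_comm.1 hbt
  have hB : t.betaᵀ * s.beta = 1 + E := by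
    rw [hE, rotDev, Matrix.mul_sub, hbt]; abel
  have hB' : s.betaᵀ * t.beta = 1 + Eᵀ := by
    have := congrArg Matrix.transpose hB
    simpa using this
  -- The orthogonality relation, which trades the symmetric part of `E` for a quadratic term.
  have horth : E + Eᵀ + Eᵀ * E = 0 := by
    have h1 : (1 + Eᵀ) * (1 + E) = 1 := by
      rw [← hB, ← hB']
      calc _ = s.betaᵀ * (t.beta * t.betaᵀ) * s.beta := by simp only [Matrix.mul_assoc]
        _ = 1 := by rw [hbt', Matrix.mul_one, transpose_beta_mul_beta hs]
    have h2 : (1 + Eᵀ) * (1 + E) = 1 + (E + Eᵀ + Eᵀ * E) := by noncomm_ring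
    rw [h2] at h1
    simpa using h1
  have hX : s.betaᵀ * t.shape * s.beta = Matrix.diagonal t.eig + Eᵀ * Matrix.diagonal t.eig
      + Matrix.diagonal t.eig * E + Eᵀ * Matrix.diagonal t.eig * E := by
    calc _ = (s.betaᵀ * t.beta) * Matrix.diagonal t.eig * (t.betaᵀ * s.beta) := by
          rw [Param.shape]; simp only [Matrix.mul_assoc]
      _ = _ := by rw [hB, hB']; noncomm_ring
  have ho := congrFun (congrFun horth j) h
  simp only [Matrix.add_apply, Matrix.transpose_apply, Matrix.zero_apply, Matrix.mul_apply] at ho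
  have hsum : ∑ l, (t.eig l - 1 / 2 * (t.eig h + t.eig j)) * (E l j * E l h)
      = (∑ l, E l j * t.eig l * E l h) - 1 / 2 * (t.eig h + t.eig j) * ∑ l, E l j * E l h := by
    rw [Finset.mul_sum, ← Finset.sum_sub_distrib]
    exact Finset.sum_congr rfl fun l _ => by ring
  rw [hX, hsum]
  simp only [Matrix.add_apply, Matrix.mul_diagonal, Matrix.diagonal_mul, Matrix.transpose_apply,
    Matrix.diagonal_apply,
    Matrix.mul_apply (M := Eᵀ * Matrix.diagonal t.eig)]
  -- The linear term `λ_h E_hj + λ_j E_jh` splits into `½(λ_h - λ_j)(E_hj - E_jh)` and `½(λ_h +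
  -- λ_j)(E_hj + E_jh)`; `ho` makes the second quadratic.
  linear_combination (1 / 2 * (t.eig h + t.eig j)) * ho

/-- The filter is confined to `ParamSpace m` because orthogonality of the nearby `β` is used
exactly. -/
lemma transpose_beta_shape_beta_isLittleO {t : Param m} (ht : t ∈ ParamSpace m) (j h : Idx m) :
    (fun s : Param m => (s.betaᵀ * t.shape * s.beta) j h - (if j = h then t.eig j else 0)
        - 1 / 2 * (t.eig h - t.eig j) * (rotDev t s h j - rotDev t s j h))
      =o[𝓝[ParamSpace m] t] fun s => ‖s - t‖ := by
  have h1 : (fun s => ∑ l, (t.eig l - 1 / 2 * (t.eig h + t.eig j)) *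
      (rotDev t s l j * rotDev t s l h)) =o[𝓝 t] fun s => ‖s - t‖ :=
    IsLittleO.fun_sum fun l _ => IsLittleO.const_mul_left
      (isLittleO_of_isBigO_mul_one (rotDev_isBigO t l j) (rotDev_isLittleO_one t l h)) _
  refine (h1.mono nhdsWithin_le_nhds).congr' ?_ .rfl
  filter_upwards [self_mem_nhdsWithin] with s hs
  exact (transpose_beta_shape_beta ht hs j h).symm

lemma transpose_beta_shape_beta_self {t : Param m} (ht : t ∈ ParamSpace m) (j h : Idx m) :
    (t.betaᵀ * t.shape * t.beta) j h = if j = h then t.eig j else 0 := by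
  have h := transpose_beta_shape_beta ht ht j h
  simpa [rotDev, sub_eq_zero] using h

/-! ### Perturbation of the eigenvalues -/

/-- Product rule at a zero of `ρ`: a prefactor contributes only its limit, so it need only converge.
This is why increments of the scale leave no first-order trace. -/
lemma isLittleO_mul_add {α : Type*} {l : Filter α} {K ρ r u : α → ℝ} {K₀ : ℝ}
    (hK : Tendsto K l (𝓝 K₀)) (hρ : (fun s => ρ s + r s) =o[l] u) (hr : r =O[l] u) :
    (fun s => K s * ρ s + K₀ * r s) =o[l] u := by
  have h1 : (fun s => K s * (ρ s + r s)) =o[l] u :=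
    isLittleO_of_isBigO_one_mul (hK.isBigO_one ℝ) hρ
  have h2 : (fun s => r s * (K s - K₀)) =o[l] u := by
    have : (fun s => K s - K₀) =o[l] fun _ => (1 : ℝ) := by
      rw [isLittleO_one_iff]
      simpa using hK.sub_const K₀
    exact isLittleO_of_isBigO_mul_one hr this
  refine (h1.sub h2).congr_left fun s => by ring

lemma inv_mul_isLittleO {y₀ : ℝ} (hy : y₀ ≠ 0) :
    (fun y : ℝ => y⁻¹ * y₀ - 1 + y₀⁻¹ * (y - y₀)) =o[𝓝 y₀] fun y => y - y₀ := by
  have h := (hasDerivAt_iff_isLittleO.1 (hasDerivAt_inv hy)).const_mul_left y₀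
  refine h.congr_left fun y => ?_
  simp only [smul_eq_mul]
  field_simp
  ring

lemma prod_mul_inv_isLittleO {y₀ : Fin m → ℝ} (hy : ∀ j, y₀ j ≠ 0) :
    (fun y : Fin m → ℝ => ∏ j, y j * (y₀ j)⁻¹ - 1 - ∑ j, (y₀ j)⁻¹ * (y j - y₀ j))
      =o[𝓝 y₀] fun y => y - y₀ := by
  have h : HasFDerivAt (fun y : Fin m → ℝ => ∏ j, y j * (y₀ j)⁻¹)
      (∑ j, (∏ i ∈ Finset.univ.erase j, y₀ i * (y₀ i)⁻¹) •
        ((y₀ j)⁻¹ • ContinuousLinearMap.proj (R := ℝ) (φ := fun _ : Fin m => ℝ) j)) y₀ :=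
    HasFDerivAt.finsetProd fun j _ => (hasFDerivAt_apply j y₀).mul_const _
  refine (hasFDerivAt_iff_isLittleO.1 h).congr_left fun y => ?_
  simp [hy]

/-- Because `λ₁` is the inverse product of the others, its inverse ratio is a product of ratios
`λ_j(s)/λ_j(t)`, and the relative increments add up to the sum appearing in `infoIII_mulVec`. -/
lemma eig_ratio_isLittleO {t : Param m} (ht : t ∈ ParamSpace m) (i : Fin m) :
    (fun s : Param m => (s.eigTail i)⁻¹ * t.eigTail i - (s.eig 0)⁻¹ * t.eig 0
      + ((t.eigTail i)⁻¹ * (s.eigTail i - t.eigTail i)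
        + ∑ j, (t.eigTail j)⁻¹ * (s.eigTail j - t.eigTail j))) =o[𝓝 t] fun s => ‖s - t‖ := by
  have hne := eigTail_ne_zero ht
  have hcont : Continuous fun s : Param m => s.eigTail := by
    simp only [Param.eigTail]; fun_prop
  have hbig : (fun s : Param m => s.eigTail - t.eigTail) =O[𝓝 t] fun s => ‖s - t‖ := by
    refine IsBigO.of_bound 1 (.of_forall fun s => ?_)
    rw [one_mul, norm_norm]
    exact (norm_fst_le ((s - t).2.2)).trans
      ((norm_snd_le ((s - t).2)).trans (norm_snd_le (s - t)))
  have h1 := ((inv_mul_isLittleO (hne i)).comp_tendsto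
    ((differentiable_eigTail i).continuous.tendsto t)).trans_isBigO
      (DifferentiableAt.sub_isBigO_norm (differentiable_eigTail i t))
  have h2 := ((prod_mul_inv_isLittleO hne).comp_tendsto (hcont.tendsto t)).trans_isBigO hbig
  refine (h1.sub h2).congr_left fun s => ?_
  simp only [Function.comp_apply, Param.eig_zero, Finset.prod_mul_distrib, Finset.prod_inv_distrib,
    inv_inv]
  ring

/-! ### Linearization of the two central sequences at the population scatter -/

lemma smul_scatter_eq (t : Param m) (κ : ℝ) :
    (fun p q => κ * t.scatter p q) = (κ * t.scaleSq) • t.shape := by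
  funext p q
  simp [Param.scatter, mul_assoc]

/-- At `t` both terms of the difference in `coefIII`, paired with the shape, equal `1`. Rotations
move the diagonal only to second order, so the eigenvalue ratios alone give the linear term. -/
lemma coefIII_isLittleO {t : Param m} (ht : t ∈ ParamSpace m) (κ : ℝ) (i : Fin m) :
    (fun s => ∑ p, ∑ q, (coefIII i p q s - coefIII i p q t) * (κ * t.scatter p q)
      + gaussConst m * κ * (infoIII t (phi1 m) *ᵥ (s.eigTail - t.eigTail)) i)
      =o[𝓝[ParamSpace m] t] fun s => ‖s - t‖ := by
  set F := 𝓝[ParamSpace m] t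
  have hF : F ≤ 𝓝 t := nhdsWithin_le_nhds
  have hne := eigTail_ne_zero ht i
  have h0 := (ht.2.2.1 0).ne'
  have hX := fun j => transpose_beta_shape_beta_isLittleO ht j j
  simp only [sub_self, mul_zero, sub_zero, if_true] at hX
  have k1 : Tendsto (fun s : Param m => (s.eigTail i)⁻¹) F (𝓝 (t.eigTail i)⁻¹) :=
    (((differentiable_eigTail i).continuous.tendsto t).mono_left hF).inv₀ hne
  have k2 : Tendsto (fun s : Param m => (s.eig 0)⁻¹) F (𝓝 (t.eig 0)⁻¹) :=
    ((differentiableAt_eig ht 0).continuousAt.tendsto.mono_left hF).inv₀ h0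
  have k3 : Tendsto (fun s : Param m => (s.scaleSq)⁻¹) F (𝓝 (t.scaleSq)⁻¹) :=
    ((differentiable_scaleSq.continuous.tendsto t).mono_left hF).inv₀ ht.1.ne'
  have hρ : (fun s : Param m => ((s.eigTail i)⁻¹ * (s.betaᵀ * t.shape * s.beta) i.succ i.succ
        - (s.eig 0)⁻¹ * (s.betaᵀ * t.shape * s.beta) 0 0)
      + ((t.eigTail i)⁻¹ * (s.eigTail i - t.eigTail i)
        + ∑ j, (t.eigTail j)⁻¹ * (s.eigTail j - t.eigTail j))) =o[F] fun s => ‖s - t‖ := by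
    have a1 := isLittleO_of_isBigO_one_mul (k1.isBigO_one ℝ) (hX i.succ)
    have a2 := isLittleO_of_isBigO_one_mul (k2.isBigO_one ℝ) (hX 0)
    refine ((a1.sub a2).add ((eig_ratio_isLittleO ht i).mono hF)).congr_left fun s => ?_
    rw [t.eig_succ]
    ring
  have hr : (fun s : Param m => (t.eigTail i)⁻¹ * (s.eigTail i - t.eigTail i)
        + ∑ j, (t.eigTail j)⁻¹ * (s.eigTail j - t.eigTail j)) =O[F] fun s => ‖s - t‖ := by
    have hb := fun j =>
      (DifferentiableAt.sub_isBigO_norm (differentiable_eigTail (m := m) j t)).mono hF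
    exact ((hb i).const_mul_left _).add (IsBigO.fun_sum fun j _ => (hb j).const_mul_left _)
  have h := (isLittleO_mul_add (k3.mul k1) hρ hr).const_mul_left
    (gaussConst m / 2 * (κ * t.scaleSq))
  refine h.congr_left fun s => ?_
  have e : ∀ s : Param m, ∑ p, ∑ q, coefIII i p q s * (κ * t.scatter p q)
      = gaussConst m / 2 * (κ * t.scaleSq) * (s.scaleSq⁻¹ * (s.eigTail i)⁻¹ *
      ((s.eigTail i)⁻¹ * (s.betaᵀ * t.shape * s.beta) i.succ i.succ
        - (s.eig 0)⁻¹ * (s.betaᵀ * t.shape * s.beta) 0 0)) := fun s => by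
    have := sum_coefIII i s (fun p q => κ * t.scatter p q)
    rw [this, smul_scatter_eq]
    simp only [Matrix.mul_smul, Matrix.smul_mul, Matrix.smul_apply, smul_eq_mul]
    ring
  simp only [sub_mul, Finset.sum_sub_distrib]
  rw [e s, e t, infoIII_mulVec ht, transpose_beta_shape_beta_self ht,
    transpose_beta_shape_beta_self ht, if_pos rfl, if_pos rfl, t.eig_succ, inv_mul_cancel₀ hne,
    inv_mul_cancel₀ h0]
  have hs := ht.1.ne'
  simp only [Pi.sub_apply]
  field_simp
  ring

/-- The columns of `Gmat` are tangent to the rotation group at `β`, so pairing with them reads off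
the skew part of the rotation. -/
lemma transpose_Gmat_mulVec_vecBeta (t s : Param m) (w : UpperPair m) :
    ((Gmat t)ᵀ *ᵥ (s.vecBeta - t.vecBeta)) w
      = rotDev t s w.1.2 w.1.1 - rotDev t s w.1.1 w.1.2 := by
  rw [transpose_Gmat_mulVec, rotDev_apply, rotDev_apply, ← Finset.sum_sub_distrib]
  rfl

/-- The off-diagonal entries vanish at `t`, so all prefactors may be frozen there. The constant is
`(λ_h⁻¹ - λ_j⁻¹) · ½(λ_h - λ_j) = -½ ν_jh⁻¹`. -/
lemma coefIV_isLittleO {t : Param m} (ht : t ∈ ParamSpace m) (κ : ℝ) (r : Idx m × Idx m) :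
    (fun s => ∑ p, ∑ q, (coefIV r p q s - coefIV r p q t) * (κ * t.scatter p q)
      + gaussConst m * κ * (infoIV t (phi1 m) *ᵥ (s.vecBeta - t.vecBeta)) r)
      =o[𝓝[ParamSpace m] t] fun s => ‖s - t‖ := by
  set F := 𝓝[ParamSpace m] t
  have hF : F ≤ 𝓝 t := nhdsWithin_le_nhds
  have hne : ∀ w : UpperPair m, w.1.1 ≠ w.1.2 := fun w => w.2.ne
  have k1 : ∀ j, Tendsto (fun s : Param m => (s.eig j)⁻¹) F (𝓝 (t.eig j)⁻¹) := fun j =>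
    ((differentiableAt_eig ht j).continuousAt.tendsto.mono_left hF).inv₀ (ht.2.2.1 j).ne'
  have k2 : ∀ w, Tendsto (fun s : Param m => Gmat s r w) F (𝓝 (Gmat t r w)) := fun w =>
    ((differentiable_Gmat r w).continuous.tendsto t).mono_left hF
  have k3 : Tendsto (fun s : Param m => (s.scaleSq)⁻¹) F (𝓝 (t.scaleSq)⁻¹) :=
    ((differentiable_scaleSq.continuous.tendsto t).mono_left hF).inv₀ ht.1.ne'
  have hsum : (fun s => ∑ w : UpperPair m, (s.scaleSq⁻¹ * Gmat s r w *
      ((s.eig w.1.2)⁻¹ - (s.eig w.1.1)⁻¹) * (s.betaᵀ * t.shape * s.beta) w.1.1 w.1.2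
      + t.scaleSq⁻¹ * Gmat t r w * ((t.eig w.1.2)⁻¹ - (t.eig w.1.1)⁻¹) *
        (-(1 / 2 * (t.eig w.1.2 - t.eig w.1.1) *
          (rotDev t s w.1.2 w.1.1 - rotDev t s w.1.1 w.1.2))))) =o[F] fun s => ‖s - t‖ := by
    refine IsLittleO.fun_sum fun w _ => isLittleO_mul_add
      ((k3.mul (k2 w)).mul ((k1 _).sub (k1 _))) ?_ ?_
    · refine (transpose_beta_shape_beta_isLittleO ht w.1.1 w.1.2).congr_left fun s => ?_
      rw [if_neg (hne w)]
      ring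
    · exact ((((rotDev_isBigO t _ _).sub (rotDev_isBigO t _ _)).const_mul_left _).neg_left).mono hF
  refine (hsum.const_mul_left (gaussConst m / 2 * (κ * t.scaleSq))).congr_left fun s => ?_
  have e : ∀ s : Param m, ∑ p, ∑ q, coefIV r p q s * (κ * t.scatter p q)
      = gaussConst m / 2 * (κ * t.scaleSq) * ∑ w : UpperPair m, s.scaleSq⁻¹ * Gmat s r w *
        ((s.eig w.1.2)⁻¹ - (s.eig w.1.1)⁻¹) * (s.betaᵀ * t.shape * s.beta) w.1.1 w.1.2 :=
    fun s => by
    have := sum_coefIV r s (fun p q => κ * t.scatter p q)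
    rw [this, smul_scatter_eq]
    simp only [Matrix.mul_smul, Matrix.smul_mul, Matrix.smul_apply, smul_eq_mul, Finset.mul_sum]
    exact Finset.sum_congr rfl fun w _ => by ring
  have e0 : ∑ w : UpperPair m, t.scaleSq⁻¹ * Gmat t r w *
        ((t.eig w.1.2)⁻¹ - (t.eig w.1.1)⁻¹) * (t.betaᵀ * t.shape * t.beta) w.1.1 w.1.2 = 0 :=
    Finset.sum_eq_zero fun w _ => by
      rw [transpose_beta_shape_beta_self ht, if_neg (hne w), mul_zero]
  simp only [sub_mul, Finset.sum_sub_distrib]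
  rw [e s, e t, e0, mul_zero, sub_zero, infoIV_mulVec, Finset.sum_add_distrib, mul_add]
  congr 1
  simp only [Finset.mul_sum]
  refine Finset.sum_congr rfl fun w _ => ?_
  rw [transpose_Gmat_mulVec_vecBeta, nu]
  have hs := ht.1.ne'
  have h1 := (ht.2.2.1 w.1.1).ne'
  have h2 := (ht.2.2.1 w.1.2).ne'
  field_simp
  ring

/-! ### Local linearity in probability -/

lemma scatterMean_apply (θ : Idx m → ℝ) {n : ℕ} (x : Fin n → Idx m → ℝ) (p q : Idx m) :
    scatterMean θ x p q = (n : ℝ)⁻¹ * ∑ i, (x i p - θ p) * (x i q - θ q) := by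
  simp [scatterMean, Matrix.sum_apply, Matrix.vecMulVec_apply]

lemma scatterMean_recenter (θ θ' : Idx m → ℝ) {n : ℕ} (hn : 0 < n) (x : Fin n → Idx m → ℝ)
    (p q : Idx m) : scatterMean θ' x p q = scatterMean θ x p q
      - ((n : ℝ)⁻¹ * ∑ i, (x i p - θ p)) * (θ' q - θ q)
      - (θ' p - θ p) * ((n : ℝ)⁻¹ * ∑ i, (x i q - θ q)) + (θ' p - θ p) * (θ' q - θ q) := by
  have hn0 : (n : ℝ) ≠ 0 := by exact_mod_cast hn.ne'
  have h : ∑ i, (x i p - θ' p) * (x i q - θ' q) = ∑ i, (x i p - θ p) * (x i q - θ q)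
      - (∑ i, (x i p - θ p)) * (θ' q - θ q) - (θ' p - θ p) * ∑ i, (x i q - θ q)
      + n * ((θ' p - θ p) * (θ' q - θ q)) := by
    have : (n : ℝ) * ((θ' p - θ p) * (θ' q - θ q))
        = ∑ _i : Fin n, (θ' p - θ p) * (θ' q - θ q) := by simp
    rw [this, Finset.sum_mul, Finset.mul_sum, ← Finset.sum_sub_distrib, ← Finset.sum_sub_distrib,
      ← Finset.sum_add_distrib]
    exact Finset.sum_congr rfl fun i _ => by ring
  rw [scatterMean_apply, scatterMean_apply, h]
  field_simp

lemma tendsto_measure_iUnion_zero {Ω : ℕ → Type*} [∀ n, MeasurableSpace (Ω n)]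
    (P : ∀ n, Measure (Ω n)) {ι : Type*} [Fintype ι] {A : ι → ∀ n, Set (Ω n)}
    (h : ∀ i, Tendsto (fun n => P n (A i n)) atTop (𝓝 0)) :
    Tendsto (fun n => P n (⋃ i, A i n)) atTop (𝓝 0) := by
  have hs : Tendsto (fun n => ∑ i, P n (A i n)) atTop (𝓝 0) := by
    simpa using tendsto_finsetSum Finset.univ fun i _ => h i
  exact tendsto_of_tendsto_of_tendsto_of_le_of_le tendsto_const_nhds hs (fun _ => zero_le)
    fun n => (measure_iUnion_le _).trans_eq (tsum_fintype _)

/-- The general local linearity statement: a statistic which on the parameter space is `n^{1/2}`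
times a smooth linear functional of the empirical scatter is asymptotically linear in root-`n`
consistent estimators. -/
theorem tendstoZeroInProb_linearization {t : Param m} (ht : t ∈ ParamSpace m) {g : ℝ → ℝ}
    (hg : IsStdRadial4 (m + 1) g) {est : ∀ n : ℕ, (Fin n → Idx m → ℝ) → Param m}
    (hest : IsRootNConsistent t g est) {ι : Type*} [Fintype ι]
    {c : ι → Idx m → Idx m → Param m → ℝ} (hc : ∀ i p q, DifferentiableAt ℝ (c i p q) t)
    {Δ : ∀ n : ℕ, Param m → (Fin n → Idx m → ℝ) → ι → ℝ}
    (hΔ : ∀ n, ∀ s ∈ ParamSpace m, ∀ x i,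
      Δ n s x i = Real.sqrt n * ∑ p, ∑ q, c i p q s * scatterMean s.loc x p q)
    {ℓ : Param m → ι → ℝ}
    (hℓ : ∀ i, (fun s => ∑ p, ∑ q, (c i p q s - c i p q t) *
      (Dconst (m + 1) g / (m + 1) * t.scatter p q) + ℓ s i)
        =o[𝓝[ParamSpace m] t] fun s => ‖s - t‖) :
    TendstoZeroInProb (sampleLaw t g) fun n x =>
      Δ n (est n x) x - Δ n t x + Real.sqrt n • ℓ (est n x) := by
  intro δ hδ
  have hprob := isProbabilityMeasure_obsLaw ht hg.toIsStdRadial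
  set C : Idx m → Idx m → ℝ := fun p q => Dconst (m + 1) g / (m + 1) * t.scatter p q with hC
  rw [ENNReal.tendsto_nhds_zero]
  intro ε hε
  have hε2 : 0 < ε / 2 := ENNReal.div_pos hε.ne' (by simp)
  obtain ⟨K, hK⟩ := hest.bounded (ε / 2) hε2
  -- Enlarged to be positive, since it serves as a divisor.
  set K' := max K 0 + 1 with hK'
  have hK'0 : 0 < K' := by positivity
  have hKK' : K < K' := (le_max_left _ _).trans_lt (lt_add_one _)
  -- Tolerance `δ / K'`: where `√n ‖est - t‖ ≤ K'`, the rescaled remainder is at most `δ`.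
  have hlin := fun i => (isLittleO_linearization (l := 𝓝[ParamSpace m] t) nhdsWithin_le_nhds
    (hc i) C (hℓ i)).def (div_pos hδ hK'0)
  have hev := eventually_all.2 hlin
  rw [Metric.nhdsWithin_basis_ball.prod (Metric.nhds_basis_ball.prod Metric.nhds_basis_ball)
    |>.eventually_iff] at hev
  obtain ⟨⟨ρ₁, ρ₂, ρ₃⟩, ⟨hρ₁, hρ₂, hρ₃⟩, hev⟩ := hev
  simp only at hρ₁ hρ₂ hρ₃ hev
  set A : ∀ n, Set (Fin n → Idx m → ℝ) := fun n => ⋃ pq : Idx m × Idx m,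
    {x | ρ₂ ≤ |(n : ℝ)⁻¹ * ∑ i, (x i pq.1 - t.loc pq.1) * (x i pq.2 - t.loc pq.2)
      - C pq.1 pq.2|} with hA
  set B : ∀ n, Set (Fin n → Idx m → ℝ) := fun n => ⋃ p : Idx m,
    {x | ρ₃ ≤ |(n : ℝ)⁻¹ * ∑ i, (x i p - t.loc p) - 0|} with hB
  have hAlim : Tendsto (fun n => sampleLaw t g n (A n)) atTop (𝓝 0) :=
    tendsto_measure_iUnion_zero _ fun pq => by
      have := tendsto_measure_pi_mean (obsLaw t g) (memLp_centered_mul_obsLaw ht hg pq.1 pq.2) hρ₂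
      rw [integral_centered_mul_obsLaw ht hg] at this
      exact this
  have hBlim : Tendsto (fun n => sampleLaw t g n (B n)) atTop (𝓝 0) :=
    tendsto_measure_iUnion_zero _ fun p => by
      have := tendsto_measure_pi_mean (obsLaw t g) (memLp_centered_obsLaw ht hg p) hρ₃
      rw [integral_centered_obsLaw ht hg] at this
      exact this
  have hABlim := hAlim.add hBlim
  rw [add_zero, ENNReal.tendsto_nhds_zero] at hABlim
  have hsq : Tendsto (fun n : ℕ => Real.sqrt n) atTop atTop :=
    Real.tendsto_sqrt_atTop.comp tendsto_natCast_atTop_atTop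
  -- The last requirement gives `K'/√n < ρ₁`, which puts the estimate in the neighbourhood where the
  -- remainder bound holds.
  filter_upwards [hK, hABlim (ε / 2) hε2, eventually_gt_atTop 0,
    hsq.eventually_gt_atTop (K' / ρ₁)] with n h1 h2 hn h3
  have hn0 : (0 : ℝ) < Real.sqrt n := Real.sqrt_pos.2 (by exact_mod_cast hn)
  have hΘ : sampleLaw t g n {x | est n x ∉ ParamSpace m} = 0 := hest.mem_paramSpace n
  -- A large error forces a large rescaled deviation, a failure of one of the laws of large numbers,
  -- or an estimate outside the parameter space.
  have hsub : {x | δ < ‖Δ n (est n x) x - Δ n t x + Real.sqrt n • ℓ (est n x)‖}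
      ⊆ {x | K < ‖Real.sqrt n • (est n x - t)‖} ∪ (A n ∪ B n)
        ∪ {x | est n x ∉ ParamSpace m} := by
    intro x hx
    by_contra hcon
    simp only [hA, hB, Set.mem_union, Set.mem_ofPred_eq, Set.mem_iUnion, not_or, not_lt, not_not,
      not_exists, not_le] at hcon
    obtain ⟨⟨c1, c2, c3⟩, c4⟩ := hcon
    rw [Set.mem_ofPred_eq] at hx
    refine absurd hx (not_lt.2 ?_)
    rw [norm_smul, Real.norm_of_nonneg hn0.le] at c1
    have hdist : dist (est n x) t < ρ₁ := by
      rw [dist_eq_norm]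
      have : ‖est n x - t‖ ≤ K' / Real.sqrt n := by
        rw [le_div_iff₀' hn0]; exact c1.trans hKK'.le
      refine this.trans_lt ?_
      rw [div_lt_iff₀ hn0]
      rwa [div_lt_iff₀' hρ₁] at h3
    have key := hev (x := (est n x, (fun p q => scatterMean t.loc x p q),
      fun p => (n : ℝ)⁻¹ * ∑ i, (x i p - t.loc p))) ⟨⟨hdist, c4⟩, by
        rw [Metric.mem_ball, dist_pi_lt_iff hρ₂]
        intro p
        rw [dist_pi_lt_iff hρ₂]
        intro q
        simpa [Real.dist_eq, scatterMean_apply] using c2 (p, q), by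
        rw [Metric.mem_ball, dist_pi_lt_iff hρ₃]
        intro p
        simpa [Real.dist_eq] using c3 p⟩
    rw [pi_norm_le_iff_of_nonneg hδ.le]
    intro i
    have hi := key i
    simp only [← scatterMean_recenter t.loc (est n x).loc hn x, norm_norm] at hi
    simp only [Pi.add_apply, Pi.sub_apply, Pi.smul_apply, smul_eq_mul]
    rw [hΔ n _ c4, hΔ n _ ht, ← mul_sub, ← mul_add, norm_mul, Real.norm_of_nonneg hn0.le]
    calc _ ≤ Real.sqrt n * (δ / K' * ‖est n x - t‖) := by gcongr
      _ = δ / K' * (Real.sqrt n * ‖est n x - t‖) := by ring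
      _ ≤ δ / K' * K' := by
          gcongr
          exact c1.trans hKK'.le
      _ = δ := by field_simp
  calc _ ≤ sampleLaw t g n ({x | K < ‖Real.sqrt n • (est n x - t)‖} ∪ (A n ∪ B n)
        ∪ {x | est n x ∉ ParamSpace m}) := measure_mono hsub
    _ ≤ sampleLaw t g n {x | K < ‖Real.sqrt n • (est n x - t)‖}
        + (sampleLaw t g n (A n) + sampleLaw t g n (B n)) + 0 := by
        refine (measure_union_le _ _).trans (add_le_add ?_ hΘ.le)
        exact (measure_union_le _ _).trans (add_le_add le_rfl (measure_union_le _ _))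
    _ ≤ ε / 2 + ε / 2 + 0 := by gcongr
    _ = ε := by rw [add_zero, ENNReal.add_halves]

end EllipticalPCA

end

/-! ### Local asymptotic linearity of the eigenvalue and eigenvector blocks -/

theorem lemma4p2 (m : ℕ) (t : EllipticalPCA.Param m) (ht : t ∈ EllipticalPCA.ParamSpace m)
    (g : ℝ → ℝ) (hg : EllipticalPCA.IsStdRadial4 (m + 1) g)
    (est : ∀ n : ℕ, (Fin n → EllipticalPCA.Idx m → ℝ) → EllipticalPCA.Param m)
    (hest : EllipticalPCA.IsRootNConsistent t g est) :
    EllipticalPCA.TendstoZeroInProb (EllipticalPCA.sampleLaw t g) (fun n x =>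
      EllipticalPCA.centralIII (est n x) (EllipticalPCA.phi1 m) x
        - EllipticalPCA.centralIII t (EllipticalPCA.phi1 m) x
        + (EllipticalPCA.gaussConst m * (EllipticalPCA.Dconst (m + 1) g / ((m : ℝ) + 1))) •
          (EllipticalPCA.infoIII t (EllipticalPCA.phi1 m) *ᵥ
            (Real.sqrt n • ((est n x).eigTail - t.eigTail)))) ∧
    EllipticalPCA.TendstoZeroInProb (EllipticalPCA.sampleLaw t g) (fun n x =>
      EllipticalPCA.centralIV (est n x) (EllipticalPCA.phi1 m) x
        - EllipticalPCA.centralIV t (EllipticalPCA.phi1 m) x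
        + (EllipticalPCA.gaussConst m * (EllipticalPCA.Dconst (m + 1) g / ((m : ℝ) + 1))) •
          (EllipticalPCA.infoIV t (EllipticalPCA.phi1 m) *ᵥ
            (Real.sqrt n • ((est n x).vecBeta - t.vecBeta)))) := by
  constructor
  · have h := EllipticalPCA.tendstoZeroInProb_linearization ht hg hest
      (EllipticalPCA.differentiableAt_coefIII ht)
      (Δ := fun n s x => EllipticalPCA.centralIII s (EllipticalPCA.phi1 m) x)
      (fun n s hs x i => EllipticalPCA.centralIII_phi1 hs x i)
      (ℓ := fun s => (EllipticalPCA.gaussConst m * (EllipticalPCA.Dconst (m + 1) g / (m + 1))) •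
        (EllipticalPCA.infoIII t (EllipticalPCA.phi1 m) *ᵥ (s.eigTail - t.eigTail)))
      (fun i => EllipticalPCA.coefIII_isLittleO ht _ i)
    -- The factor `√n` passes through the information matrix by linearity.
    simpa only [Matrix.mulVec_smul, smul_comm (Real.sqrt _)] using h
  · have h := EllipticalPCA.tendstoZeroInProb_linearization ht hg hest
      (EllipticalPCA.differentiableAt_coefIV ht)
      (Δ := fun n s x => EllipticalPCA.centralIV s (EllipticalPCA.phi1 m) x)
      (fun n s hs x r => EllipticalPCA.centralIV_phi1 hs x r)
      (ℓ := fun s => (EllipticalPCA.gaussConst m * (EllipticalPCA.Dconst (m + 1) g / (m + 1))) •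
        (EllipticalPCA.infoIV t (EllipticalPCA.phi1 m) *ᵥ (s.vecBeta - t.vecBeta)))
      (fun r => EllipticalPCA.coefIV_isLittleO ht _ r)
    simpa only [Matrix.mulVec_smul, smul_comm (Real.sqrt _)] using h
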